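/- Let $|E|$ denote the Lebesgue measure of $E\subset\mathbb R$, let $\mathbf 1_E$ be the indicator function of $E$, let $\widehat f(\xi)=\int_{\mathbb R}e^{-2\pi i x\xi}f(x)\,dx$, and let $\mathbb B=[-1,1]$. For $q\in(2,\infty)$ put $q'=q/(q-1)$, and for Lebesgue measurable $E\subset\mathbb R$ with $0<|E|<\infty$ define $$\Phi_q(E)=|E|^{-1/q'}\,\|\widehat{\mathbf 1_E}\|_{L^q(\mathbb R)},\qquad \operatorname{dist}(E,\mathfrak E)=\inf_{I}\frac{|I\,\Delta\,E|}{|E|},$$ where the infimum runs over all compact intervals $I$ with $|I|=|E|$. Let $K_q:\mathbb R\to\mathbb R$ be the continuous function with $\widehat{K_q}=\widehat{\mathbf 1_{\mathbb B}}\,|\widehat{\mathbf 1_{\mathbb B}}|^{q-2}$. Proposition 2.8. Let $q>3$ and suppose that $$\inf_{|x|\le 1-\delta}K_q(x)>\sup_{|x|\ge 1+\delta}K_q(x)\qquad\text{for all }\delta\in(0,1].$$ Then there exist $c_q>0$ and $\eta>0$ such that $$\Phi_q(E)\le\Phi_q(\mathbb B)-c_q\operatorname{dist}(E,\mathfrak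 E)^2$$ for every Lebesgue measurable set $E\subset\mathbb R$ with $0<|E|<\infty$ and $\operatorname{dist}(E,\mathfrak E)<\eta$. -/

import Mathlib

/-!
After an affine change of variable `|E| = 2` and `|E ∩ (0, ∞)| = 1`. Write `𝟏_E = 𝟏_B + f` with
`B = [-1, 1]`: then `f ≤ 0` on `B`, `f ≥ 0` off `B`, and `f` has mean zero on each half-line. Let
`δ = ∫ |f| = |B ∆ E|`.

Expanding `‖a + w‖ ^ q` at `a = 𝟏_B^` and integrating gives the first-order term `q ∫ K_q f`. Here
`K_q` is a cosine transform of `sinc |sinc| ^ (q - 2)`; writing `t ^ (-s)` as a Laplace transform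
and using the antiperiodicity of `sin |sin| ^ s` shows that `K_q` decreases strictly on `[0, 2]` and
stays below `K_q 1` by a fixed amount beyond `2`. The first-order term is therefore at most `-κ m`,
where `m = ∫ |f x| * dist (|x|, 1) dx`, the distance being truncated at `1`.

On the other hand `‖f^‖ ≤ δ`, and the vanishing of the mean on both half-lines improves this to
`‖f^ ξ‖ ≤ 2 π (1 + |ξ|) m`. Together these bound the remainder by `O(δ ^ θ * m)` for some `θ > 0`,
which is absorbed for small `δ`. Since `|f| ≤ 1`, one has `δ ^ 2 ≤ 16 m`, so the gain is quadratic
in `δ`.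
-/

open MeasureTheory
open scoped FourierTransform symmDiff

namespace FourierExtremizer

/-- The closed unit ball `{x : |x| ≤ 1}` of `ℝ`, that is, the interval `[-1, 1]`. -/
def unitBall : Set ℝ := {x : ℝ | |x| ≤ 1}

/-- The Fourier transform `ξ ↦ ∫ exp (-2πi x ξ) 1_E(x) dx` of the indicator function of `E`. -/
noncomputable def indicatorHat (E : Set ℝ) : ℝ → ℂ :=
  𝓕 (E.indicator (fun _ : ℝ => (1 : ℂ)))

/-- `Φ_q(E) = |E| ^ (-1/q') * ‖(1_E)^‖_q`, with `q' = q / (q - 1)`. -/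
noncomputable def Phi (q : ℝ) (E : Set ℝ) : ℝ :=
  (volume E).toReal ^ (-(1 / (q / (q - 1)))) *
    (eLpNorm (indicatorHat E) (ENNReal.ofReal q) volume).toReal

/-- Ellipsoids of `ℝ`: the images of the unit ball under affine automorphisms. -/
def IsEllipsoid (S : Set ℝ) : Prop :=
  ∃ T : ℝ ≃ᵃ[ℝ] ℝ, S = T '' unitBall

/-- The normalized distance from `E` to the set of ellipsoids (in `ℝ`: compact intervals): the
infimum of `|S ∆ E| / |E|` over all ellipsoids `S` with `|S| = |E|`. -/
noncomputable def distEllipsoids (E : Set ℝ) : ℝ :=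
  sInf {r : ℝ | ∃ S : Set ℝ, IsEllipsoid S ∧ volume S = volume E ∧
    r = (volume (S ∆ E)).toReal / (volume E).toReal}

/-- The function `K_q` whose Fourier transform is `(1_B)^ * |(1_B)^| ^ (q - 2)`, `B` the unit ball.
For `q > 2` this product is integrable, real-valued and even, so that `K_q` is its inverse Fourier
transform, given by an absolutely convergent integral; the latter is real-valued, hence equal to
its real part. -/
noncomputable def K (q : ℝ) (x : ℝ) : ℝ :=
  (𝓕⁻ (fun ξ : ℝ =>
    indicatorHat unitBall ξ * ((‖indicatorHat unitBall ξ‖ ^ (q - 2) : ℝ) : ℂ)) x).re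

/-- In dimension one the ellipsoids are exactly the nondegenerate compact intervals. -/
theorem isEllipsoid_iff (S : Set ℝ) :
    IsEllipsoid S ↔ ∃ a b : ℝ, a < b ∧ S = Set.Icc a b := by
  have key : ∀ m r : ℝ, r ≠ 0 →
      (fun x : ℝ => r * x + m) '' unitBall = Set.Icc (m - |r|) (m + |r|) := by
    intro m r hr
    ext y
    simp only [unitBall, Set.mem_image, Set.mem_ofPred_eq, Set.mem_Icc]
    constructor
    · rintro ⟨x, hx, rfl⟩
      have h : |r * x| ≤ |r| := by
        rw [abs_mul]; exact mul_le_of_le_one_right (abs_nonneg r) hx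
      have h2 := abs_le.1 h
      constructor <;> linarith [h2.1, h2.2]
    · rintro ⟨h1, h2⟩
      refine ⟨(y - m) / r, ?_, by field_simp; ring⟩
      rw [abs_div, div_le_one (abs_pos.2 hr), abs_le]
      constructor <;> linarith
  constructor
  · rintro ⟨T, rfl⟩
    have hT : ∀ x : ℝ, T x = T.linear 1 * x + T 0 := by
      intro x
      have h1 := T.map_vadd 0 x
      have h2 : T.linear x = x * T.linear 1 := by
        have := T.linear.map_smul x 1
        simpa using this
      simp only [vadd_eq_add, add_zero] at h1
      rw [h1, h2]; ring
    have hr : T.linear 1 ≠ 0 := by simp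
    refine ⟨T 0 - |T.linear 1|, T 0 + |T.linear 1|, ?_, ?_⟩
    · have := abs_pos.2 hr
      linarith
    · rw [← key _ _ hr]
      exact Set.image_congr (fun x _ => hT x)
  · rintro ⟨a, b, hab, rfl⟩
    have hr : (b - a) / 2 ≠ 0 := by
      have : 0 < b - a := by linarith
      positivity
    refine ⟨(LinearEquiv.smulOfNeZero ℝ ℝ ((b - a) / 2) hr).toAffineEquiv.trans
      (AffineEquiv.constVAdd ℝ ℝ ((a + b) / 2)), ?_⟩
    have h := key ((a + b) / 2) ((b - a) / 2) hr
    have habs : |(b - a) / 2| = (b - a) / 2 := abs_of_pos (by linarith)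
    rw [habs] at h
    have e1 : (a + b) / 2 - (b - a) / 2 = a := by ring
    have e2 : (a + b) / 2 + (b - a) / 2 = b := by ring
    rw [e1, e2] at h
    rw [← h]
    apply Set.image_congr
    intro x _
    simp [add_comm]

end FourierExtremizer

namespace FourierExtremizer

open Real Set Filter Topology

/-! ### Signed powers of the sinc function and their cosine transform -/

lemma mul_sinc (t : ℝ) : t * sinc t = sin t := by
  rcases eq_or_ne t 0 with rfl | ht
  · simp
  · rw [sinc_of_ne_zero ht, mul_div_cancel₀ _ ht]

lemma abs_sinc_le (t : ℝ) : |sinc t| ≤ 2 / (1 + |t|) := by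
  have hmul : |t| * |sinc t| ≤ 1 := by
    rw [← abs_mul, mul_sinc]
    exact abs_sin_le_one t
  rw [le_div_iff₀ (by positivity)]
  linarith [abs_sinc_le_one t]

lemma integrable_one_add_abs_rpow_mul_abs_sinc_rpow {θ r : ℝ} (hr : 0 ≤ r) (h : 1 < r - θ) :
    Integrable fun t ↦ (1 + |t|) ^ θ * |sinc t| ^ r := by
  have : Measurable sinc := continuous_sinc.measurable
  have hdom : Integrable fun t : ℝ ↦ (2 : ℝ) ^ r * (1 + ‖t‖) ^ (-(r - θ)) :=
    (integrable_one_add_norm (by simpa using h)).const_mul _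
  refine hdom.mono' (by fun_prop) (ae_of_all _ fun t ↦ ?_)
  have hpos : 0 < 1 + |t| := by positivity
  rw [norm_of_nonneg (by positivity), norm_eq_abs]
  calc (1 + |t|) ^ θ * |sinc t| ^ r ≤ (1 + |t|) ^ θ * (2 / (1 + |t|)) ^ r := by
        gcongr
        exact abs_sinc_le t
    _ = 2 ^ r * (1 + |t|) ^ (-(r - θ)) := by
        rw [div_rpow zero_le_two hpos.le, neg_sub, rpow_sub hpos]
        ring

lemma integrable_abs_sinc_rpow {r : ℝ} (hr : 1 < r) : Integrable fun t ↦ |sinc t| ^ r := by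
  simpa using integrable_one_add_abs_rpow_mul_abs_sinc_rpow (θ := 0) (by linarith)
    (by simpa using hr)

lemma integral_eq_two_mul_integral_Ioi_of_even {f : ℝ → ℝ} (hf : f.Even) :
    ∫ t, f t = 2 * ∫ t in Ioi 0, f t := by
  have habs (t : ℝ) : f |t| = f t := by
    rcases abs_choice t with h | h <;> rw [h]
    exact hf t
  simpa only [habs] using integral_comp_abs (f := f)

/-- The signed power `sinc |sinc| ^ s`; for `s = q - 2` it is, up to scaling, the function whose
inverse Fourier transform is `K q`. -/
noncomputable def sincPow (s t : ℝ) : ℝ := sinc t * |sinc t| ^ s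

lemma continuous_sincPow {s : ℝ} (hs : 0 ≤ s) : Continuous (sincPow s) :=
  continuous_sinc.mul (continuous_sinc.abs.rpow_const fun _ ↦ Or.inr hs)

lemma sincPow_neg (s t : ℝ) : sincPow s (-t) = sincPow s t := by simp [sincPow]

lemma abs_sincPow {s : ℝ} (hs : 0 < s) (t : ℝ) : |sincPow s t| = |sinc t| ^ (s + 1) := by
  rw [sincPow, abs_mul, abs_rpow_of_nonneg (abs_nonneg _), abs_abs,
    rpow_add_one' (abs_nonneg _) (by linarith), mul_comm]

lemma integrable_sincPow {s : ℝ} (hs : 0 < s) : Integrable (sincPow s) := by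
  refine (integrable_abs_sinc_rpow (r := s + 1) (by linarith)).mono'
    (continuous_sincPow hs.le).aestronglyMeasurable (ae_of_all _ fun t ↦ ?_)
  rw [norm_eq_abs, abs_sincPow hs]

/-- The cosine transform of `sincPow s`. -/
noncomputable def sincPowCos (s x : ℝ) : ℝ := ∫ t, sincPow s t * cos (x * t)

lemma integrable_sincPow_mul_cos {s : ℝ} (hs : 0 < s) (x : ℝ) :
    Integrable fun t ↦ sincPow s t * cos (x * t) :=
  (integrable_sincPow hs).mul_bdd (c := 1) (by fun_prop) (ae_of_all _ fun _ ↦ abs_cos_le_one _)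

lemma sincPowCos_neg (s x : ℝ) : sincPowCos s (-x) = sincPowCos s x := by
  simp [sincPowCos]

lemma sincPowCos_abs (s x : ℝ) : sincPowCos s |x| = sincPowCos s x := by
  rcases abs_choice x with h | h <;> rw [h]
  exact sincPowCos_neg s x

lemma sincPowCos_eq_two_mul_integral_Ioi (s x : ℝ) :
    sincPowCos s x = 2 * ∫ t in Ioi 0, sincPow s t * cos (x * t) :=
  integral_eq_two_mul_integral_Ioi_of_even fun t ↦ by rw [sincPow_neg, mul_neg, cos_neg]

/-- The sine transform of `t * sincPow s t = sin t |sinc t| ^ s` on the half-line, which is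
`-1/2` times the derivative of `sincPowCos s`. -/
noncomputable def sincPowSin (s x : ℝ) : ℝ :=
  ∫ t in Ioi 0, sin t * |sinc t| ^ s * sin (x * t)

lemma integrable_sin_mul_abs_sinc_rpow_mul_sin {s : ℝ} (hs : 1 < s) (x : ℝ) :
    Integrable fun t ↦ sin t * |sinc t| ^ s * sin (x * t) :=
  ((integrable_abs_sinc_rpow hs).bdd_mul (c := 1) (by fun_prop)
    (ae_of_all _ fun _ ↦ abs_sin_le_one _)).mul_bdd (c := 1) (by fun_prop)
    (ae_of_all _ fun _ ↦ abs_sin_le_one _)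

lemma abs_sin_mul_abs_sinc_rpow_mul_sin_le (s x t : ℝ) :
    |sin t * |sinc t| ^ s * sin (x * t)| ≤ |sinc t| ^ s := by
  have hnonneg : 0 ≤ |sinc t| ^ s := by positivity
  rw [abs_mul, abs_mul, abs_of_nonneg hnonneg]
  calc |sin t| * |sinc t| ^ s * |sin (x * t)| ≤ 1 * |sinc t| ^ s * 1 := by
        gcongr <;> exact abs_sin_le_one _
    _ = |sinc t| ^ s := by ring

lemma hasDerivAt_sincPow_mul_cos (s t x : ℝ) :
    HasDerivAt (fun x ↦ sincPow s t * cos (x * t)) (-(sin t * |sinc t| ^ s * sin (x * t))) x := by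
  refine ((hasDerivAt_mul_const t).cos.const_mul (sincPow s t)).congr_deriv ?_
  rw [sincPow, ← mul_sinc t]
  ring

lemma hasDerivAt_sincPowCos {s : ℝ} (hs : 1 < s) (x : ℝ) :
    HasDerivAt (sincPowCos s) (-2 * sincPowSin s x) x := by
  have heven : (fun t ↦ sin t * |sinc t| ^ s * sin (x * t)).Even := fun t ↦ by simp
  have hderiv : ∫ t, -(sin t * |sinc t| ^ s * sin (x * t)) = -2 * sincPowSin s x := by
    rw [integral_neg, integral_eq_two_mul_integral_Ioi_of_even heven, sincPowSin, neg_mul]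
  rw [← hderiv]
  exact (hasDerivAt_integral_of_dominated_loc_of_deriv_le (s := univ)
    (F := fun x t ↦ sincPow s t * cos (x * t)) (bound := fun t ↦ |sinc t| ^ s) univ_mem
    (Eventually.of_forall fun y ↦ (integrable_sincPow_mul_cos (by linarith) y).1)
    (integrable_sincPow_mul_cos (by linarith) x)
    (integrable_sin_mul_abs_sinc_rpow_mul_sin hs x).neg.1
    (ae_of_all _ fun t y _ ↦ (norm_neg _).trans_le (abs_sin_mul_abs_sinc_rpow_mul_sin_le s y t))
    (integrable_abs_sinc_rpow hs)
    (ae_of_all _ fun t y _ ↦ hasDerivAt_sincPow_mul_cos s t y)).2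

/-! ### Laplace and sine transforms of antiperiodic functions -/

lemma integral_Ioi_eq_intervalIntegral_add {f : ℝ → ℂ} (hf : IntegrableOn f (Ioi 0)) {c : ℝ}
    (hc : 0 ≤ c) :
    ∫ t in Ioi 0, f t = (∫ t in 0..c, f t) + ∫ t in Ioi 0, f (t + c) := by
  have hshift := (measurePreserving_add_right volume c).setIntegral_preimage_emb
    (measurableEmbedding_addRight c) f (Ioi c)
  rw [preimage_add_const_Ioi, sub_self] at hshift
  rw [hshift, intervalIntegral.integral_interval_add_Ioi hf (hf.mono_set (Ioi_subset_Ioi hc))]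

section Antiperiodic

variable {g : ℝ → ℝ} {c l : ℝ}

lemma integrableOn_mul_cexp (hg : Continuous g) (hanti : g.Antiperiodic c) (hc : 0 < c)
    (hl : 0 < l) (x : ℝ) :
    IntegrableOn (fun t ↦ (g t : ℂ) * Complex.exp ((-l + x * Complex.I) * t)) (Ioi 0) := by
  obtain ⟨C, hC⟩ := (hanti.periodic_two_mul.isBounded_of_continuous (by positivity)
    hg).exists_norm_le
  refine (integrableOn_exp_mul_complex_Ioi (by simpa using hl) 0).bdd_mul (c := C)
    (by fun_prop) (ae_of_all _ fun t ↦ ?_)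
  simpa using hC (g t) (mem_range_self t)

lemma one_add_cexp_mul_integral_Ioi (hg : Continuous g) (hanti : g.Antiperiodic c) (hc : 0 < c)
    (hl : 0 < l) (x : ℝ) :
    (1 + Complex.exp ((-l + x * Complex.I) * c)) *
        ∫ t in Ioi 0, (g t : ℂ) * Complex.exp ((-l + x * Complex.I) * t) =
      ∫ t in 0..c, (g t : ℂ) * Complex.exp ((-l + x * Complex.I) * t) := by
  have hshift (t : ℝ) : (g (t + c) : ℂ) * Complex.exp ((-l + x * Complex.I) * ↑(t + c)) =
      -Complex.exp ((-l + x * Complex.I) * c) *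
        ((g t : ℂ) * Complex.exp ((-l + x * Complex.I) * t)) := by
    rw [hanti, Complex.ofReal_add, mul_add, Complex.exp_add, Complex.ofReal_neg]
    ring
  have hsplit := integral_Ioi_eq_intervalIntegral_add
    (integrableOn_mul_cexp hg hanti hc hl x) hc.le
  simp only [hshift, integral_const_mul] at hsplit
  linear_combination hsplit

lemma im_cexp_mul (g l x u : ℝ) :
    ((g : ℂ) * Complex.exp ((-l + x * Complex.I) * u)).im = g * exp (-l * u) * sin (x * u) := by
  simp [Complex.exp_im, mul_assoc]

open scoped ComplexConjugate in
lemma im_conj_one_add_cexp_mul_integral (hg : Continuous g) (hsymm : ∀ t, g (c - t) = g t)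
    (l x : ℝ) :
    (conj (1 + Complex.exp ((-l + x * Complex.I) * c)) *
      ∫ t in 0..c, (g t : ℂ) * Complex.exp ((-l + x * Complex.I) * t)).im =
    ∫ u in 0..c, g u * (exp (-l * u) - exp (-l * (2 * c - u))) * sin (x * u) := by
  set F : ℝ → ℂ := fun t ↦ (g t : ℂ) * Complex.exp ((-l + x * Complex.I) * t) with hF
  have hFc : Continuous F := by fun_prop
  have hreflect : ∫ t in 0..c, F t = ∫ u in 0..c, F (c - u) := by
    rw [intervalIntegral.integral_comp_sub_left, sub_self, sub_zero]
  have him (u : ℝ) : (F u + conj (Complex.exp ((-l + x * Complex.I) * c)) * F (c - u)).im =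
      g u * (exp (-l * u) - exp (-l * (2 * c - u))) * sin (x * u) := by
    have hexp : conj (Complex.exp ((-l + x * Complex.I) * c)) * F (c - u) =
        g u * Complex.exp (↑(-l * (2 * c - u)) + ↑(-(x * u)) * Complex.I) := by
      simp only [hF, hsymm, ← Complex.exp_conj, mul_left_comm _ (g u : ℂ), ← Complex.exp_add]
      congr 2
      push_cast [map_mul, map_add, map_neg, Complex.conj_ofReal, Complex.conj_I]
      ring
    rw [hexp, Complex.add_im, im_cexp_mul, Complex.im_ofReal_mul, Complex.exp_im]
    simp only [Complex.add_re, Complex.add_im, Complex.ofReal_re, Complex.ofReal_im,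
      Complex.re_ofReal_mul, Complex.im_ofReal_mul, Complex.I_re, Complex.I_im, mul_zero, add_zero,
      zero_add, mul_one, sin_neg]
    ring
  rw [map_add, map_one, add_mul, one_mul]
  nth_rw 2 [hreflect]
  rw [← intervalIntegral.integral_const_mul, ← intervalIntegral.integral_add
    (hFc.intervalIntegrable _ _) (Continuous.intervalIntegrable (by fun_prop) _ _)]
  refine (intervalIntegral.intervalIntegral_im (𝕜 := ℂ)
    (Continuous.intervalIntegrable (by fun_prop) _ _)).symm.trans ?_
  exact intervalIntegral.integral_congr fun u _ ↦ him u

lemma normSq_one_add_cexp_mul_integral_Ioi (hg : Continuous g) (hanti : g.Antiperiodic c)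
    (hsymm : ∀ t, g (c - t) = g t) (hc : 0 < c) (hl : 0 < l) (x : ℝ) :
    Complex.normSq (1 + Complex.exp ((-l + x * Complex.I) * c)) *
        ∫ t in Ioi 0, g t * exp (-l * t) * sin (x * t) =
      ∫ u in 0..c, g u * (exp (-l * u) - exp (-l * (2 * c - u))) * sin (x * u) := by
  have him : ∫ t in Ioi 0, g t * exp (-l * t) * sin (x * t) =
      (∫ t in Ioi 0, (g t : ℂ) * Complex.exp ((-l + x * Complex.I) * t)).im := by
    simp only [← im_cexp_mul]
    exact integral_im (𝕜 := ℂ) (integrableOn_mul_cexp hg hanti hc hl x)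
  rw [him, ← Complex.im_ofReal_mul, Complex.normSq_eq_conj_mul_self, mul_assoc,
    one_add_cexp_mul_integral_Ioi hg hanti hc hl, im_conj_one_add_cexp_mul_integral hg hsymm]

end Antiperiodic

section Reflection

variable {W : ℝ → ℝ} {x a b : ℝ}

lemma sin_mul_two_mul_sub (hxa : x * a = π) (u : ℝ) : sin (x * (2 * a - u)) = -sin (x * u) := by
  rw [mul_sub, mul_left_comm, hxa, sin_two_pi_sub]

lemma integral_mul_sin_eq_add_reflect (hW : Continuous W) (hxa : x * a = π) (b : ℝ) :
    ∫ u in 0..b, W u * sin (x * u) = (∫ u in 0..(2 * a - b), W u * sin (x * u)) +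
      ∫ u in (2 * a - b)..a, (W u - W (2 * a - u)) * sin (x * u) := by
  have hint (v w : ℝ) : IntervalIntegrable (fun u ↦ W u * sin (x * u)) volume v w :=
    Continuous.intervalIntegrable (by fun_prop) _ _
  have hreflect : ∫ u in (2 * a - b)..a, W (2 * a - u) * sin (x * u) =
      -∫ u in a..b, W u * sin (x * u) := by
    have h := intervalIntegral.integral_comp_sub_left (a := 2 * a - b) (b := a)
      (fun u ↦ W u * sin (x * u)) (2 * a)
    simp only [sin_mul_two_mul_sub hxa, mul_neg, intervalIntegral.integral_neg,
      sub_sub_cancel] at h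
    rw [← neg_eq_iff_eq_neg, h, two_mul, add_sub_cancel_right]
  simp only [sub_mul]
  rw [intervalIntegral.integral_sub (hint _ _) (Continuous.intervalIntegrable (by fun_prop) _ _),
    hreflect, sub_neg_eq_add, intervalIntegral.integral_add_adjacent_intervals (hint _ _)
    (hint _ _), intervalIntegral.integral_add_adjacent_intervals (hint _ _) (hint _ _)]

lemma integral_mul_sin_pos_of_reflect (hW : Continuous W) (hpos : ∀ u ∈ Ioo 0 b, 0 < W u)
    (hx : 0 < x) (hxa : x * a = π) (hab : a < b) (hba : b < 2 * a)
    (hrefl : ∀ u ∈ Icc (2 * a - b) a, W (2 * a - u) ≤ W u) :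
    0 < ∫ u in 0..b, W u * sin (x * u) := by
  rw [integral_mul_sin_eq_add_reflect hW hxa]
  refine add_pos_of_pos_of_nonneg ?_ ?_
  · refine intervalIntegral.intervalIntegral_pos_of_pos_on
      (Continuous.intervalIntegrable (by fun_prop) _ _) (fun u hu ↦ ?_) (by linarith)
    refine mul_pos (hpos u ⟨hu.1, by linarith [hu.2]⟩)
      (sin_pos_of_pos_of_lt_pi (mul_pos hx hu.1) ?_)
    rw [← hxa]
    gcongr
    linarith [hu.2]
  · refine intervalIntegral.integral_nonneg (by linarith) fun u hu ↦
      mul_nonneg (sub_nonneg.2 (hrefl u hu)) (sin_nonneg_of_nonneg_of_le_pi ?_ ?_)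
    · exact mul_nonneg hx.le (by linarith [hu.1])
    · rw [← hxa]
      gcongr
      exact hu.2

lemma integral_mul_sin_pos_of_mul_le_pi (hW : Continuous W) (hpos : ∀ u ∈ Ioo 0 b, 0 < W u)
    (hb : 0 < b) (hx : 0 < x) (hxb : x * b ≤ π) :
    0 < ∫ u in 0..b, W u * sin (x * u) := by
  refine intervalIntegral.intervalIntegral_pos_of_pos_on
    (Continuous.intervalIntegrable (by fun_prop) _ _) (fun u hu ↦ ?_) hb
  refine mul_pos (hpos u hu) (sin_pos_of_pos_of_lt_pi (mul_pos hx hu.1) (hxb.trans_lt' ?_))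
  gcongr
  exact hu.2

end Reflection

/-- The signed power `sin |sin| ^ s`, the numerator of `t ↦ sin t * |sinc t| ^ s`. -/
noncomputable def sinPow (s t : ℝ) : ℝ := sin t * |sin t| ^ s

lemma continuous_sinPow {s : ℝ} (hs : 0 ≤ s) : Continuous (sinPow s) :=
  continuous_sin.mul (continuous_sin.abs.rpow_const fun _ ↦ Or.inr hs)

lemma sinPow_antiperiodic (s : ℝ) : (sinPow s).Antiperiodic π := fun t ↦ by simp [sinPow]

lemma sinPow_pi_sub (s t : ℝ) : sinPow s (π - t) = sinPow s t := by simp [sinPow]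

lemma sinPow_pos {s t : ℝ} (h0 : 0 < t) (hpi : t < π) : 0 < sinPow s t := by
  have := sin_pos_of_pos_of_lt_pi h0 hpi
  rw [sinPow]
  positivity

lemma sinPow_le_sinPow {s u v : ℝ} (hs : 0 ≤ s) (hv : 0 ≤ sin v) (h : sin v ≤ sin u) :
    sinPow s v ≤ sinPow s u := by
  have hu : 0 ≤ sin u := hv.trans h
  unfold sinPow
  rw [abs_of_nonneg hv, abs_of_nonneg hu]
  gcongr

lemma sin_two_mul_sub_le_sin {a u : ℝ} (ha : π / 2 ≤ a) (hapi : a ≤ π) (hu : 0 ≤ u)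
    (hua : u ≤ a) : sin (2 * a - u) ≤ sin u := by
  have hsin : 0 ≤ sin (a - u) := sin_nonneg_of_nonneg_of_le_pi (by linarith) (by linarith)
  have hcos : cos a ≤ 0 := cos_nonpos_of_pi_div_two_le_of_le ha (by linarith [pi_pos])
  have hsub : sin (2 * a - u) - sin u = 2 * (sin (a - u) * cos a) := by
    rw [sin_sub_sin, ← mul_assoc]
    ring_nf
  linarith [mul_nonpos_of_nonneg_of_nonpos hsin hcos]

lemma exp_sub_exp_reflect_le {l a b u : ℝ} (hl : 0 ≤ l) (hua : u ≤ a) :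
    exp (-l * (2 * a - u)) - exp (-l * (2 * b - (2 * a - u))) ≤
      exp (-l * u) - exp (-l * (2 * b - u)) := by
  have h₁ : exp (-l * (2 * a - u)) ≤ exp (-l * u) := exp_le_exp.2 (by nlinarith)
  have h₂ : exp (-l * (2 * b - u)) ≤ exp (-l * (2 * b - (2 * a - u))) :=
    exp_le_exp.2 (by nlinarith)
  linarith

lemma integral_sinPow_mul_exp_mul_sin_pos {s l x : ℝ} (hs : 0 ≤ s) (hl : 0 < l) (hx0 : 0 < x)
    (hx2 : x < 2) : 0 < ∫ t in Ioi 0, sinPow s t * exp (-l * t) * sin (x * t) := by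
  have hg := continuous_sinPow hs
  set W : ℝ → ℝ := fun u ↦ sinPow s u * (exp (-l * u) - exp (-l * (2 * π - u)))
  have hexp {u : ℝ} (hu : u ≤ π) : 0 ≤ exp (-l * u) - exp (-l * (2 * π - u)) :=
    sub_nonneg.2 (exp_le_exp.2 (by nlinarith))
  have hWpos : ∀ u ∈ Ioo 0 π, 0 < W u := fun u hu ↦
    mul_pos (sinPow_pos hu.1 hu.2) (sub_pos.2 (exp_lt_exp.2 (by nlinarith [hu.2])))
  have hpos : 0 < ∫ u in 0..π, W u * sin (x * u) := by
    rcases le_or_gt x 1 with hx1 | hx1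
    · exact integral_mul_sin_pos_of_mul_le_pi (by fun_prop) hWpos pi_pos hx0
        (mul_le_of_le_one_left pi_pos.le hx1)
    · have hxa : x * (π / x) = π := mul_div_cancel₀ _ hx0.ne'
      have hapi : π / x < π := div_lt_self pi_pos hx1
      have hpia : π < 2 * (π / x) := by nlinarith
      refine integral_mul_sin_pos_of_reflect (by fun_prop) hWpos hx0 hxa hapi hpia
        fun u hu ↦ mul_le_mul (sinPow_le_sinPow hs ?_ ?_) (exp_sub_exp_reflect_le hl.le hu.2) ?_ ?_
      · exact sin_nonneg_of_nonneg_of_le_pi (by linarith [hu.2]) (by linarith [hu.1])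
      · exact sin_two_mul_sub_le_sin (by linarith) hapi.le (by linarith [hu.1]) hu.2
      · exact hexp (by linarith [hu.1])
      · exact (sinPow_pos (by linarith [hu.1]) (by linarith [hu.2])).le
  rw [← normSq_one_add_cexp_mul_integral_Ioi hg (sinPow_antiperiodic s) (sinPow_pi_sub s) pi_pos
    hl] at hpos
  exact pos_of_mul_pos_right hpos (Complex.normSq_nonneg _)

section RpowInv

variable {s : ℝ} {φ : ℝ → ℝ}

lemma integral_rpow_mul_exp_mul_const (hs : 0 < s) {t : ℝ} (ht : 0 < t) (c : ℝ) :
    ∫ l in Ioi 0, l ^ (s - 1) * exp (-(t * l)) * c = Gamma s * (t⁻¹ ^ s * c) := by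
  rw [integral_mul_const, integral_rpow_mul_exp_neg_mul_Ioi hs ht, one_div]
  ring

lemma integrable_prod_rpow_mul_exp_mul (hs : 0 < s)
    (hφ : IntegrableOn (fun t ↦ t⁻¹ ^ s * φ t) (Ioi 0)) (hmeas : Measurable φ) :
    Integrable (fun z : ℝ × ℝ ↦ z.2 ^ (s - 1) * exp (-(z.1 * z.2)) * φ z.1)
      ((volume.restrict (Ioi 0)).prod (volume.restrict (Ioi 0))) := by
  rw [integrable_prod_iff (Measurable.aestronglyMeasurable (by fun_prop))]
  constructor
  · filter_upwards [ae_restrict_mem measurableSet_Ioi] with t ht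
    have hker := integrableOn_rpow_mul_exp_neg_mul_rpow (s := s - 1) (by linarith) one_pos ht
    simpa using hker.mul_const (φ t)
  · refine (hφ.norm.const_mul (Gamma s)).congr ?_
    filter_upwards [ae_restrict_mem measurableSet_Ioi] with t ht
    rw [norm_mul, norm_of_nonneg (rpow_nonneg (inv_pos.2 ht).le s),
      ← integral_rpow_mul_exp_mul_const hs ht]
    refine setIntegral_congr_fun measurableSet_Ioi fun l (hl : 0 < l) ↦ ?_
    rw [norm_mul, norm_of_nonneg (r := l ^ (s - 1) * exp (-(t * l))) (by positivity)]

lemma integral_rpow_inv_mul_pos_of_laplace_pos (hs : 0 < s)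
    (hφ : IntegrableOn (fun t ↦ t⁻¹ ^ s * φ t) (Ioi 0)) (hmeas : Measurable φ)
    (hpos : ∀ l, 0 < l → 0 < ∫ t in Ioi 0, exp (-l * t) * φ t) :
    0 < ∫ t in Ioi 0, t⁻¹ ^ s * φ t := by
  have hint := integrable_prod_rpow_mul_exp_mul hs hφ hmeas
  have hGamma : ∫ t in Ioi 0, ∫ l in Ioi 0, l ^ (s - 1) * exp (-(t * l)) * φ t =
      Gamma s * ∫ t in Ioi 0, t⁻¹ ^ s * φ t := by
    rw [← integral_const_mul]
    exact setIntegral_congr_fun measurableSet_Ioi fun t ht ↦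
      integral_rpow_mul_exp_mul_const hs ht _
  have hinner : ∀ l : ℝ, 0 < l →
      0 < ∫ t in Ioi 0, l ^ (s - 1) * exp (-(t * l)) * φ t := by
    intro l hl
    simp only [mul_assoc, integral_const_mul, mul_comm _ l, ← neg_mul]
    exact mul_pos (rpow_pos_of_pos hl _) (hpos l hl)
  have houter : 0 < ∫ l in Ioi 0, ∫ t in Ioi 0, l ^ (s - 1) * exp (-(t * l)) * φ t := by
    rw [setIntegral_pos_iff_support_of_nonneg_ae _ hint.integral_prod_right]
    · refine lt_of_lt_of_le ?_ (measure_mono (s := Ioi (0 : ℝ))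
        fun l hl ↦ ⟨(hinner l hl).ne', hl⟩)
      simp
    · filter_upwards [ae_restrict_mem measurableSet_Ioi] with l hl using (hinner l hl).le
  rw [← integral_integral_swap hint, hGamma] at houter
  exact pos_of_mul_pos_right houter (Gamma_pos_of_pos hs).le

end RpowInv

lemma rpow_inv_mul_sinPow (s x : ℝ) {t : ℝ} (ht : 0 < t) :
    t⁻¹ ^ s * (sinPow s t * sin (x * t)) = sin t * |sinc t| ^ s * sin (x * t) := by
  rw [sinPow, sinc_of_ne_zero ht.ne', div_eq_mul_inv, abs_mul, abs_of_pos (inv_pos.2 ht),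
    mul_rpow (abs_nonneg _) (inv_pos.2 ht).le]
  ring

lemma sincPowSin_pos {s x : ℝ} (hs : 1 < s) (hx0 : 0 < x) (hx2 : x < 2) :
    0 < sincPowSin s x := by
  have hs0 : 0 < s := by linarith
  have hcongr : EqOn (fun t ↦ sin t * |sinc t| ^ s * sin (x * t))
      (fun t ↦ t⁻¹ ^ s * (sinPow s t * sin (x * t))) (Ioi 0) := fun t ht ↦
    (rpow_inv_mul_sinPow s x ht).symm
  rw [sincPowSin, setIntegral_congr_fun measurableSet_Ioi hcongr]
  refine integral_rpow_inv_mul_pos_of_laplace_pos hs0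
    ((integrable_sin_mul_abs_sinc_rpow_mul_sin hs x).integrableOn.congr_fun hcongr
      measurableSet_Ioi) ?_ fun l hl ↦ ?_
  · have := continuous_sinPow hs0.le
    exact Continuous.measurable (by fun_prop)
  · simpa only [mul_comm, mul_left_comm, mul_assoc] using
      integral_sinPow_mul_exp_mul_sin_pos hs0.le hl hx0 hx2

lemma strictAntiOn_sincPowCos {s : ℝ} (hs : 1 < s) : StrictAntiOn (sincPowCos s) (Icc 0 2) := by
  refine strictAntiOn_of_deriv_neg (convex_Icc 0 2)
    (fun x _ ↦ (hasDerivAt_sincPowCos hs x).continuousAt.continuousWithinAt) fun x hx ↦ ?_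
  rw [interior_Icc] at hx
  rw [(hasDerivAt_sincPowCos hs x).deriv]
  linarith [sincPowSin_pos hs hx.1 hx.2]

/-! ### A uniform gap between the cosine transform at `1` and beyond `2` -/

lemma mul_cos_le_sin {t : ℝ} (h0 : 0 < t) (hpi : t < π) : t * cos t ≤ sin t := by
  rcases le_or_gt (cos t) 0 with hcos | hcos
  · exact (mul_nonpos_of_nonneg_of_nonpos h0.le hcos).trans (sin_pos_of_pos_of_lt_pi h0 hpi).le
  · have ht : t < π / 2 := by
      by_contra! hc
      exact (cos_nonpos_of_pi_div_two_le_of_le hc (by linarith)).not_gt hcos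
    have htan := lt_tan h0 ht
    rw [tan_eq_sin_div_cos, lt_div_iff₀ hcos] at htan
    exact htan.le

lemma sincPow_eq_rpow {s t : ℝ} (h0 : 0 < t) (hpi : t < π) :
    sincPow s t = (sin t / t) ^ (s + 1) := by
  have h := div_pos (sin_pos_of_pos_of_lt_pi h0 hpi) h0
  rw [sincPow, sinc_of_ne_zero h0.ne', abs_of_pos h, rpow_add_one h.ne', mul_comm]

lemma sincPow_pi (s : ℝ) : sincPow s π = 0 := by
  simp [sincPow, sinc_of_ne_zero pi_ne_zero]

lemma hasDerivAt_sincPow (s : ℝ) {t : ℝ} (h0 : 0 < t) (hpi : t < π) :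
    HasDerivAt (sincPow s)
      ((cos t * t - sin t * 1) / t ^ 2 * (s + 1) * (sin t / t) ^ (s + 1 - 1)) t := by
  have hpos := div_pos (sin_pos_of_pos_of_lt_pi h0 hpi) h0
  refine (((hasDerivAt_sin t).div (hasDerivAt_id t) h0.ne').rpow_const
    (Or.inl hpos.ne')).congr_of_eventuallyEq ?_
  filter_upwards [Ioo_mem_nhds h0 hpi] with u hu using sincPow_eq_rpow hu.1 hu.2

lemma deriv_sincPow_nonpos {s t : ℝ} (hs : 0 ≤ s) (h0 : 0 < t) (hpi : t < π) :
    deriv (sincPow s) t ≤ 0 := by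
  have hpos := div_pos (sin_pos_of_pos_of_lt_pi h0 hpi) h0
  rw [(hasDerivAt_sincPow s h0 hpi).deriv]
  exact mul_nonpos_of_nonpos_of_nonneg (mul_nonpos_of_nonpos_of_nonneg
    (div_nonpos_of_nonpos_of_nonneg (by linarith [mul_cos_le_sin h0 hpi]) (by positivity))
    (by positivity)) (by positivity)

lemma mul_sub_mul_le_integral_mul_deriv {f m m' : ℝ → ℝ} {a b : ℝ} (hab : a ≤ b)
    (hf : ContinuousOn f (Icc a b)) (hdf : ∀ t ∈ Ioo a b, DifferentiableAt ℝ f t)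
    (hf' : ∀ t ∈ Ioo a b, deriv f t ≤ 0) (hm : ∀ t, HasDerivAt m (m' t) t)
    (hm' : Continuous m') (hpos : ∀ t ∈ Ioo a b, 0 ≤ m t) :
    f b * m b - f a * m a ≤ ∫ t in a..b, f t * m' t := by
  have hmc : Continuous m := continuous_iff_continuousAt.2 fun t ↦ (hm t).continuousAt
  refine intervalIntegral.sub_le_integral_of_hasDeriv_right_of_le (g := fun t ↦ f t * m t)
    hab (hf.mul hmc.continuousOn)
    (fun t ht ↦ ((hdf t ht).hasDerivAt.mul (hm t)).hasDerivWithinAt)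
    (hf.mul hm'.continuousOn).integrableOn_Icc fun t ht ↦ ?_
  linarith [mul_nonpos_of_nonpos_of_nonneg (hf' t ht) (hpos t ht)]

lemma mul_sub_mul_le_integral_sincPow {s : ℝ} (hs : 0 ≤ s) {a b : ℝ} (ha : 0 ≤ a) (hab : a ≤ b)
    (hb : b ≤ π) {m m' : ℝ → ℝ} (hm : ∀ t, HasDerivAt m (m' t) t) (hm' : Continuous m')
    (hpos : ∀ t ∈ Ioo a b, 0 ≤ m t) :
    sincPow s b * m b - sincPow s a * m a ≤ ∫ t in a..b, sincPow s t * m' t :=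
  mul_sub_mul_le_integral_mul_deriv hab (continuous_sincPow hs).continuousOn
    (fun _ ht ↦ (hasDerivAt_sincPow s (ha.trans_lt ht.1) (ht.2.trans_le hb)).differentiableAt)
    (fun _ ht ↦ deriv_sincPow_nonpos hs (ha.trans_lt ht.1) (ht.2.trans_le hb)) hm hm' hpos

lemma sin_mul_div_le_sin {x t : ℝ} (hx : 1 ≤ x) (h0 : 0 ≤ t) (ht : t ≤ π / 2) :
    sin (x * t) / x ≤ sin t := by
  have hx0 : 0 < x := by linarith
  have hpi := pi_pos
  rcases le_or_gt (x * t) π with hxt | hxt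
  · have hconc := strictConcaveOn_sin_Icc.concaveOn.2
      (show x * t ∈ Icc 0 π from ⟨by positivity, hxt⟩)
      (show (0 : ℝ) ∈ Icc 0 π from ⟨le_rfl, hpi.le⟩)
      (show 0 ≤ x⁻¹ by positivity) (sub_nonneg.2 (inv_le_one_of_one_le₀ hx)) (by ring)
    simp only [smul_eq_mul, sin_zero, mul_zero, add_zero, inv_mul_cancel_left₀ hx0.ne'] at hconc
    rwa [div_eq_inv_mul]
  · calc sin (x * t) / x ≤ 1 / x := by gcongr; exact sin_le_one _
      _ ≤ 2 / π * t := by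
        rw [div_le_iff₀ hx0, div_mul_eq_mul_div, div_mul_eq_mul_div, le_div_iff₀ hpi]
        nlinarith
      _ ≤ sin t := mul_le_sin h0 ht

lemma sin_mul_div_le_half {x t : ℝ} (hx : 2 ≤ x) : sin (x * t) / x ≤ 1 / 2 := by
  rw [div_le_div_iff₀ (by linarith) two_pos]
  linarith [sin_le_one (x * t)]

lemma hasDerivAt_sin_mul_div {x : ℝ} (hx : x ≠ 0) (t : ℝ) :
    HasDerivAt (fun t ↦ sin (x * t) / x) (cos (x * t)) t :=
  (((hasDerivAt_const_mul x).sin).div_const x).congr_deriv (mul_div_cancel_right₀ _ hx)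

lemma integral_sincPow_mul_cos_le {s x : ℝ} (hs : 0 ≤ s) (hx : 2 ≤ x) :
    ∫ t in 0..π, sincPow s t * cos (x * t) ≤ ∫ t in 0..(π / 6), sincPow s t * cos t := by
  have hpi := pi_pos
  have hc := continuous_sincPow hs
  have hderiv := hasDerivAt_sin_mul_div (x := x) (by linarith)
  -- Since `sincPow s` decreases, integrate by parts against the nonnegative primitives
  -- `sin t - sin (x * t) / x` on `[0, π / 6]` and `1 / 2 - sin (x * t) / x` beyond, which
  -- agree at `π / 6`.
  have hnear := mul_sub_mul_le_integral_sincPow hs (a := 0) (b := π / 6) le_rfl (by linarith)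
    (by linarith) (fun t ↦ (hasDerivAt_sin t).sub (hderiv t)) (by fun_prop)
    (fun t ht ↦ sub_nonneg.2 (sin_mul_div_le_sin (by linarith) ht.1.le (by linarith [ht.2])))
  have hfar := mul_sub_mul_le_integral_sincPow hs (a := π / 6) (b := π) (by linarith)
    (by linarith) le_rfl (fun t ↦ (hderiv t).const_sub (1 / 2)) (by fun_prop)
    (fun t _ ↦ sub_nonneg.2 (sin_mul_div_le_half hx))
  simp only [Pi.sub_apply, sin_pi_div_six, sincPow_pi, mul_zero, sin_zero, zero_div, sub_zero,
    mul_neg, mul_sub, zero_mul, intervalIntegral.integral_neg] at hnear hfar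
  rw [intervalIntegral.integral_sub (Continuous.intervalIntegrable (by fun_prop) _ _)
    (Continuous.intervalIntegrable (by fun_prop) _ _)] at hnear
  rw [← intervalIntegral.integral_add_adjacent_intervals (b := π / 6)
    (Continuous.intervalIntegrable (by fun_prop) _ _)
    (Continuous.intervalIntegrable (by fun_prop) _ _)]
  linarith

lemma hasDerivAt_abs_sin_rpow_mul_rpow {s t : ℝ} (hs : 0 < s) (ht : 0 < t) :
    HasDerivAt (fun t ↦ |sin t| ^ (s + 2) * t ^ (-(s + 1)))
      ((s + 2) * (sincPow s t * cos t) -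
        |sin t| ^ (s + 2) * ((s + 1) * t ^ (-(s + 1) - 1))) t := by
  have habs := (hasDerivAt_abs_rpow (sin t) (p := s + 2) (by linarith)).comp t (hasDerivAt_sin t)
  refine (habs.mul (hasDerivAt_rpow_const (p := -(s + 1)) (Or.inl ht.ne'))).congr_deriv ?_
  have hsinc : sincPow s t = |sin t| ^ s * sin t * t ^ (-(s + 1)) := by
    rw [sincPow, sinc_of_ne_zero ht.ne', abs_div, abs_of_pos ht, div_rpow (abs_nonneg _) ht.le,
      rpow_neg ht.le, rpow_add_one ht.ne']
    field_simp
  rw [hsinc, add_sub_cancel_right, Function.comp_apply]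
  ring

lemma integral_Ioi_pi_sincPow_mul_cos_nonneg {s : ℝ} (hs : 0 < s) :
    0 ≤ ∫ t in Ioi π, sincPow s t * cos t := by
  have hpi := pi_pos
  have hint : IntegrableOn (fun t ↦ sincPow s t * cos t) (Ioi π) := by
    simpa using (integrable_sincPow_mul_cos hs 1).integrableOn
  refine ge_of_tendsto (intervalIntegral_tendsto_integral_Ioi π hint tendsto_id) ?_
  filter_upwards [eventually_ge_atTop π] with T hT
  have hle := intervalIntegral.sub_le_integral_of_hasDeriv_right_of_le
    (φ := fun t ↦ (s + 2) * (sincPow s t * cos t)) hT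
    (fun t ht ↦
      (hasDerivAt_abs_sin_rpow_mul_rpow hs (hpi.trans_le ht.1)).continuousAt.continuousWithinAt)
    (fun t ht ↦ (hasDerivAt_abs_sin_rpow_mul_rpow hs (hpi.trans ht.1)).hasDerivWithinAt)
    (((continuous_sincPow hs.le).mul continuous_cos).const_smul
      (s + 2)).continuousOn.integrableOn_Icc
    (fun t ht ↦ sub_le_self _ (by have := hpi.trans ht.1; positivity))
  rw [sin_pi, abs_zero, zero_rpow (by linarith), zero_mul, sub_zero,
    intervalIntegral.integral_const_mul] at hle
  have hnonneg : 0 ≤ |sin T| ^ (s + 2) * T ^ (-(s + 1)) := by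
    have := hpi.trans_le hT
    positivity
  exact nonneg_of_mul_nonneg_right (hnonneg.trans hle) (by linarith)

lemma hasDerivAt_neg_half_inv_add {t : ℝ} (ht : 0 < t) :
    HasDerivAt (fun t ↦ -(1 / 2 * t⁻¹ + (sin (2 * t) + 1) / 4 * (t ^ 2)⁻¹))
      (sinc t ^ 2 + (sin (2 * t) + 1) / (2 * t ^ 3)) t := by
  refine (((hasDerivAt_inv ht.ne').const_mul _).add
    ((((hasDerivAt_const_mul 2).sin.add_const 1).div_const 4).mul
      ((hasDerivAt_pow 2 t).fun_inv (pow_ne_zero 2 ht.ne')))).neg.congr_deriv ?_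
  rw [sinc_of_ne_zero ht.ne', cos_two_mul, cos_sq', div_pow]
  push_cast
  field_simp
  ring

lemma integral_Ioi_pi_sinc_sq_le : ∫ t in Ioi π, sinc t ^ 2 ≤ 1 / (2 * π) + 1 / (4 * π ^ 2) := by
  have hpi := pi_pos
  have hsin (t : ℝ) : 0 ≤ sin (2 * t) + 1 := by linarith [neg_one_le_sin (2 * t)]
  have hint : IntegrableOn (fun t ↦ sinc t ^ 2) (Ioi π) := by
    simpa using (integrable_abs_sinc_rpow (r := 2) (by norm_num)).integrableOn
  refine le_of_tendsto (intervalIntegral_tendsto_integral_Ioi π hint tendsto_id) ?_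
  filter_upwards [eventually_ge_atTop π] with T hT
  have hle := intervalIntegral.integral_le_sub_of_hasDeriv_right_of_le
    (φ := fun t ↦ sinc t ^ 2) hT
    (fun t ht ↦
      (hasDerivAt_neg_half_inv_add (hpi.trans_le ht.1)).continuousAt.continuousWithinAt)
    (fun t ht ↦ (hasDerivAt_neg_half_inv_add (hpi.trans ht.1)).hasDerivWithinAt)
    (continuous_sinc.pow 2).continuousOn.integrableOn_Icc
    (fun t ht ↦ le_add_of_nonneg_right (div_nonneg (hsin t) (by
      have := hpi.trans ht.1
      positivity)))
  have hT : 0 ≤ 1 / 2 * T⁻¹ + (sin (2 * T) + 1) / 4 * (T ^ 2)⁻¹ :=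
    add_nonneg (by have := hpi.trans_le hT; positivity)
      (mul_nonneg (div_nonneg (hsin T) (by norm_num)) (by positivity))
  calc ∫ t in π..T, sinc t ^ 2 ≤ _ := hle
    _ ≤ 1 / 2 * π⁻¹ + (0 + 1) / 4 * (π ^ 2)⁻¹ := by
      rw [sin_two_pi]
      linarith
    _ = 1 / (2 * π) + 1 / (4 * π ^ 2) := by
      field_simp
      ring

lemma hasDerivAt_sin_cube_div_sq {t : ℝ} (ht : t ≠ 0) :
    HasDerivAt (fun t ↦ sin t ^ 3 * (3 * t ^ 2)⁻¹)
      (sinc t ^ 2 * cos t - 2 / 3 * sinc t ^ 3) t := by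
  refine (((hasDerivAt_sin t).fun_pow 3).mul
    (((hasDerivAt_pow 2 t).const_mul 3).fun_inv (by positivity))).congr_deriv ?_
  rw [sinc_of_ne_zero ht]
  push_cast
  field_simp
  ring

lemma integral_sinc_sq_mul_cos {a b : ℝ} (ha : 0 < a) (hab : a ≤ b) :
    ∫ t in a..b, sinc t ^ 2 * cos t =
      sin b ^ 3 * (3 * b ^ 2)⁻¹ - sin a ^ 3 * (3 * a ^ 2)⁻¹ + 2 / 3 * ∫ t in a..b, sinc t ^ 3 := by
  have := continuous_sinc
  have hsub : ∫ t in a..b, (sinc t ^ 2 * cos t - 2 / 3 * sinc t ^ 3) = _ :=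
    intervalIntegral.integral_eq_sub_of_hasDerivAt (fun t ht ↦ hasDerivAt_sin_cube_div_sq
      (ha.trans_le (uIcc_of_le hab ▸ ht).1).ne')
      (Continuous.intervalIntegrable (by fun_prop) _ _)
  rw [intervalIntegral.integral_sub (Continuous.intervalIntegrable (by fun_prop) _ _)
    (Continuous.intervalIntegrable (by fun_prop) _ _), intervalIntegral.integral_const_mul] at hsub
  linarith

lemma one_sub_sq_div_six_le_sinc {t : ℝ} (ht : 0 < t) : 1 - t ^ 2 / 6 ≤ sinc t := by
  rw [sinc_of_ne_zero ht.ne', le_div_iff₀ ht]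
  nlinarith [sin_gt_sub_cube ht]

lemma integral_one_sub_sq_div_six_cube (a b : ℝ) :
    ∫ t in a..b, (1 - t ^ 2 / 6) ^ 3 = (b - b ^ 3 / 6 + b ^ 5 / 60 - b ^ 7 / 1512) -
      (a - a ^ 3 / 6 + a ^ 5 / 60 - a ^ 7 / 1512) := by
  refine intervalIntegral.integral_eq_sub_of_hasDerivAt
    (f := fun t ↦ t - t ^ 3 / 6 + t ^ 5 / 60 - t ^ 7 / 1512) (fun t _ ↦ ?_)
    (Continuous.intervalIntegrable (by fun_prop) _ _)
  refine ((((hasDerivAt_id t).sub ((hasDerivAt_pow 3 t).div_const 6)).add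
    ((hasDerivAt_pow 5 t).div_const 60)).sub
      ((hasDerivAt_pow 7 t).div_const 1512)).congr_deriv ?_
  push_cast
  ring

lemma integral_sinc_cube_ge {a : ℝ} (ha : 0 < a) (ha2 : a ≤ 2) :
    ∫ t in a..2, (1 - t ^ 2 / 6) ^ 3 ≤ ∫ t in a..π, sinc t ^ 3 := by
  have hpi := pi_gt_three
  have hint (u v : ℝ) : IntervalIntegrable (fun t ↦ sinc t ^ 3) volume u v :=
    (continuous_sinc.pow 3).intervalIntegrable _ _
  have hcube : ∫ t in a..2, (1 - t ^ 2 / 6) ^ 3 ≤ ∫ t in a..2, sinc t ^ 3 := by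
    refine intervalIntegral.integral_mono_on ha2 (Continuous.intervalIntegrable (by fun_prop) _ _)
      (hint _ _) fun t ht ↦ pow_le_pow_left₀ ?_
        (one_sub_sq_div_six_le_sinc (ha.trans_le ht.1)) 3
    nlinarith [ht.1, ht.2]
  have htail : 0 ≤ ∫ t in 2..π, sinc t ^ 3 := by
    refine intervalIntegral.integral_nonneg (by linarith) fun t ht ↦ pow_nonneg ?_ 3
    rw [sinc_of_ne_zero (by linarith [ht.1])]
    exact div_nonneg (sin_nonneg_of_nonneg_of_le_pi (by linarith [ht.1]) ht.2) (by linarith [ht.1])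
  rw [← intervalIntegral.integral_add_adjacent_intervals (hint a 2) (hint 2 π)]
  linarith

lemma integral_sinc_sq_mul_cos_ge : 6 / 25 ≤ ∫ t in (π / 6)..π, sinc t ^ 2 * cos t := by
  have hpi := pi_pos
  have hlb := pi_gt_d2
  have hub := pi_lt_d2
  have hsinc := integral_sinc_cube_ge (a := π / 6) (by positivity) (by linarith)
  have hboundary : (1 / 2 : ℝ) ^ 3 * (3 * (π / 6) ^ 2)⁻¹ ≤ 153 / 1000 := by
    rw [← div_eq_mul_inv, div_le_iff₀ (by positivity)]
    nlinarith
  have hpoly : π / 6 - (π / 6) ^ 3 / 6 + (π / 6) ^ 5 / 60 - (π / 6) ^ 7 / 1512 ≤ 0.525 := by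
    have h7 : 0 ≤ (π / 6) ^ 7 := by positivity
    have h5 : (π / 6) ^ 5 ≤ (π / 6) ^ 3 :=
      pow_le_pow_of_le_one (by positivity) (by linarith) (by norm_num)
    have h3 : 0 ≤ (π / 6) ^ 3 := by positivity
    linarith
  rw [integral_one_sub_sq_div_six_cube] at hsinc
  rw [integral_sinc_sq_mul_cos (by positivity) (by linarith), sin_pi_div_six, sin_pi]
  norm_num only at hsinc hboundary hpoly ⊢
  linarith

lemma integral_sincPow_mul_cos_ge {s : ℝ} (hs : 1 ≤ s) :
    (2 / π) ^ (s - 1) * (6 / 25) ≤ ∫ t in (π / 6)..π, sincPow s t * cos t := by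
  have hpi := pi_pos
  have hc := continuous_sincPow (s := s) (by linarith)
  have := continuous_sinc
  refine (mul_le_mul_of_nonneg_left integral_sinc_sq_mul_cos_ge (by positivity)).trans ?_
  rw [← intervalIntegral.integral_const_mul]
  refine intervalIntegral.integral_mono_on_of_le_Ioo (by linarith)
    (Continuous.intervalIntegrable (by fun_prop) _ _)
    (Continuous.intervalIntegrable (by fun_prop) _ _) fun t ht ↦ ?_
  have ht0 : 0 < t := by linarith [ht.1]
  have hsin := sin_pos_of_pos_of_lt_pi ht0 ht.2
  have hpow : sincPow s t = (sin t / t) ^ (s - 1) * sinc t ^ 2 := by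
    rw [sincPow_eq_rpow ht0 ht.2, sinc_of_ne_zero ht0.ne',
      show s + 1 = (s - 1) + (2 : ℕ) by push_cast; ring, rpow_add_natCast (by positivity)]
  rw [hpow, mul_assoc]
  -- `sin t / t - 2 / π` and `cos t` have the same sign.
  rcases le_total t (π / 2) with ht2 | ht2
  · have hcos : 0 ≤ cos t := cos_nonneg_of_neg_pi_div_two_le_of_le (by linarith) ht2
    have hquot : 2 / π ≤ sin t / t := by
      rw [le_div_iff₀ ht0]
      exact mul_le_sin ht0.le ht2
    gcongr
  · have hcos : cos t ≤ 0 := cos_nonpos_of_pi_div_two_le_of_le ht2 (by linarith [ht.2])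
    have hquot : sin t / t ≤ 2 / π := by
      rw [div_le_div_iff₀ ht0 hpi]
      nlinarith [sin_le_one t]
    refine mul_le_mul_of_nonpos_right ?_ (mul_nonpos_of_nonneg_of_nonpos (by positivity) hcos)
    gcongr

lemma abs_sincPow_le_of_pi_le {s t : ℝ} (hs : 1 ≤ s) (ht : π ≤ t) :
    |sincPow s t| ≤ (1 / π) ^ (s - 1) * sinc t ^ 2 := by
  have hpi := pi_pos
  have ht0 : 0 < t := hpi.trans_le ht
  have hsinc : |sinc t| ≤ 1 / π := by
    rw [sinc_of_ne_zero ht0.ne', abs_div, abs_of_pos ht0, div_le_div_iff₀ ht0 hpi]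
    nlinarith [abs_sin_le_one t]
  rw [abs_sincPow (by linarith), show s + 1 = (s - 1) + (2 : ℕ) by push_cast; ring,
    rpow_add_natCast' (abs_nonneg _) (by push_cast; linarith), sq_abs]
  gcongr

lemma integral_Ioi_pi_sincPow_mul_cos_le {s : ℝ} (hs : 1 ≤ s) (x : ℝ) :
    ∫ t in Ioi π, sincPow s t * cos (x * t) ≤ (1 / π) ^ (s - 1) * (19 / 100) := by
  have hpi := pi_gt_d2
  have hint : Integrable fun t ↦ sinc t ^ 2 := by
    simpa using integrable_abs_sinc_rpow (r := 2) (by norm_num)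
  calc ∫ t in Ioi π, sincPow s t * cos (x * t)
      ≤ ∫ t in Ioi π, (1 / π) ^ (s - 1) * sinc t ^ 2 := by
        refine setIntegral_mono_on (integrable_sincPow_mul_cos (by linarith) x).integrableOn
          (hint.const_mul _).integrableOn measurableSet_Ioi fun t ht ↦ ?_
        refine (le_abs_self _).trans (le_trans ?_ (abs_sincPow_le_of_pi_le hs (mem_Ioi.1 ht).le))
        rw [abs_mul]
        exact mul_le_of_le_one_right (abs_nonneg _) (abs_cos_le_one _)
    _ ≤ (1 / π) ^ (s - 1) * (1 / (2 * π) + 1 / (4 * π ^ 2)) := by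
        rw [integral_const_mul]
        gcongr
        exact integral_Ioi_pi_sinc_sq_le
    _ ≤ (1 / π) ^ (s - 1) * (1 / (2 * 3.14) + 1 / (4 * 3.14 ^ 2)) := by gcongr
    _ ≤ (1 / π) ^ (s - 1) * (19 / 100) := by
        gcongr
        norm_num

lemma exists_sincPowCos_le_sub {s : ℝ} (hs : 1 ≤ s) :
    ∃ d > 0, ∀ x, 2 ≤ x → sincPowCos s x ≤ sincPowCos s 1 - d := by
  have hs0 : 0 < s := by linarith
  have hsplit (x : ℝ) : sincPowCos s x = 2 * ((∫ t in 0..π, sincPow s t * cos (x * t)) +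
      ∫ t in Ioi π, sincPow s t * cos (x * t)) := by
    have hint := integrable_sincPow_mul_cos hs0 x
    rw [sincPowCos_eq_two_mul_integral_Ioi, intervalIntegral.integral_interval_add_Ioi
      hint.integrableOn hint.integrableOn]
  have hone : (∫ t in 0..π, sincPow s t * cos t) =
      (∫ t in 0..(π / 6), sincPow s t * cos t) + ∫ t in (π / 6)..π, sincPow s t * cos t := by
    have hc := continuous_sincPow hs0.le
    exact (intervalIntegral.integral_add_adjacent_intervals
      (Continuous.intervalIntegrable (by fun_prop) _ _)
      (Continuous.intervalIntegrable (by fun_prop) _ _)).symm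
  refine ⟨2 * ((2 / π) ^ (s - 1) * (6 / 25) - (1 / π) ^ (s - 1) * (19 / 100)), ?_, fun x hx ↦ ?_⟩
  · have hmono : (1 / π) ^ (s - 1) ≤ (2 / π) ^ (s - 1) := by
      gcongr
      norm_num
    have hpos : 0 < (1 / π) ^ (s - 1) := by positivity
    linarith
  · have hx1 := hsplit 1
    simp only [one_mul] at hx1
    linarith [hsplit x, integral_sincPow_mul_cos_le hs0.le hx, integral_sincPow_mul_cos_ge hs,
      integral_Ioi_pi_sincPow_mul_cos_nonneg hs0, integral_Ioi_pi_sincPow_mul_cos_le hs x]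

/-! ### The function `K q` -/

lemma unitBall_eq_Icc : unitBall = Icc (-1) 1 := by
  ext x
  simp [unitBall, abs_le]

/-- The Fourier transform of the indicator function of `unitBall`, as a real-valued function. -/
noncomputable def ballHat (ξ : ℝ) : ℝ := 2 * sinc (2 * π * ξ)

lemma continuous_ballHat : Continuous ballHat := by
  have := continuous_sinc
  unfold ballHat
  fun_prop

lemma indicatorHat_unitBall (ξ : ℝ) : indicatorHat unitBall ξ = ballHat ξ := by
  have hint : indicatorHat unitBall ξ =
      ∫ v in (-1 : ℝ)..1, Complex.exp (((-(2 * π * ξ)) * v : ℝ) * Complex.I) := by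
    rw [indicatorHat, fourier_real_eq_integral_exp_smul, unitBall_eq_Icc,
      intervalIntegral.integral_of_le (by norm_num), ← integral_Icc_eq_integral_Ioc,
      ← integral_indicator measurableSet_Icc]
    congr with v
    by_cases hv : v ∈ Icc (-1 : ℝ) 1
    · rw [indicator_of_mem hv, indicator_of_mem hv, smul_eq_mul, mul_one]
      congr 3
      ring
    · rw [indicator_of_notMem hv, indicator_of_notMem hv, smul_zero]
  rw [hint, ballHat]
  rcases eq_or_ne ξ 0 with rfl | hξ
  · norm_num
  · have hr : 2 * π * ξ ≠ 0 := by positivity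
    rw [intervalIntegral.integral_comp_mul_left (fun v : ℝ ↦ Complex.exp (v * Complex.I))
      (neg_ne_zero.2 hr), mul_neg_one, neg_neg, mul_one, intervalIntegral.integral_symm,
      integral_exp_mul_I_eq_sinc, Complex.real_smul]
    have hr' : ((2 * π * ξ : ℝ) : ℂ) ≠ 0 := by exact_mod_cast hr
    rw [inv_neg, Complex.ofReal_neg, Complex.ofReal_inv]
    field_simp
    push_cast
    ring

/-- The function of which `K q` is the inverse Fourier transform. -/
noncomputable def weight (q ξ : ℝ) : ℝ := ballHat ξ * |ballHat ξ| ^ (q - 2)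

lemma weight_eq (q ξ : ℝ) :
    weight q ξ = 2 * 2 ^ (q - 2) * sincPow (q - 2) (2 * π * ξ) := by
  rw [weight, ballHat, sincPow, abs_mul, mul_rpow (abs_nonneg _) (abs_nonneg _), abs_two]
  ring

lemma integrable_weight {q : ℝ} (hq : 2 < q) : Integrable (weight q) := by
  simp only [funext (weight_eq q)]
  exact ((integrable_sincPow (by linarith)).comp_mul_left' (by positivity)).const_mul _

lemma integrable_cexp_smul {α : Type*} [MeasurableSpace α] {μ : Measure α} {f g : α → ℝ}
    (hf : Integrable f μ) (hg : AEStronglyMeasurable g μ) :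
    Integrable (fun x ↦ Complex.exp (g x * Complex.I) • (f x : ℂ)) μ := by
  refine (hf.ofReal (𝕜 := ℂ)).bdd_mul (c := 1) ?_
    (ae_of_all _ fun x ↦ (Complex.norm_exp_ofReal_mul_I _).le)
  exact (show Continuous fun t : ℝ ↦ Complex.exp (t * Complex.I) by
    fun_prop).comp_aestronglyMeasurable hg

lemma re_integral_cexp_smul {α : Type*} [MeasurableSpace α] {μ : Measure α} {f g : α → ℝ}
    (hf : Integrable f μ) (hg : AEStronglyMeasurable g μ) :
    (∫ x, Complex.exp (g x * Complex.I) • (f x : ℂ) ∂μ).re = ∫ x, f x * cos (g x) ∂μ := by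
  rw [← Complex.reCLM_apply, ← Complex.reCLM.integral_comp_comm (integrable_cexp_smul hf hg)]
  congr with x
  rw [Complex.reCLM_apply, smul_eq_mul, Complex.re_mul_ofReal, Complex.exp_ofReal_mul_I_re,
    mul_comm]

lemma re_fourier_ofReal {f : ℝ → ℝ} (hf : Integrable f) (ξ : ℝ) :
    (𝓕 (fun x ↦ (f x : ℂ)) ξ).re = ∫ x, f x * cos (2 * π * x * ξ) := by
  rw [fourier_real_eq_integral_exp_smul,
    re_integral_cexp_smul hf (Continuous.aestronglyMeasurable (by fun_prop))]
  congr with x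
  rw [← cos_neg]
  congr 2
  ring

lemma K_eq_integral {q : ℝ} (hq : 2 < q) (x : ℝ) :
    K q x = ∫ ξ, weight q ξ * cos (2 * π * x * ξ) := by
  have hweight (ξ : ℝ) : indicatorHat unitBall ξ *
      ((‖indicatorHat unitBall ξ‖ ^ (q - 2) : ℝ) : ℂ) = (weight q ξ : ℂ) := by
    rw [indicatorHat_unitBall, Complex.norm_real, norm_eq_abs, ← Complex.ofReal_mul, weight]
  rw [K, funext hweight, fourierInv_eq', re_integral_cexp_smul (integrable_weight hq)
    (Continuous.aestronglyMeasurable (by fun_prop))]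
  simp only [RCLike.inner_apply, conj_trivial, mul_assoc]

lemma K_eq_sincPowCos {q : ℝ} (hq : 2 < q) (x : ℝ) :
    K q x = (2 * 2 ^ (q - 2) * (2 * π)⁻¹) * sincPowCos (q - 2) x := by
  have h (ξ : ℝ) : weight q ξ * cos (2 * π * x * ξ) =
      (2 * 2 ^ (q - 2)) * (fun t ↦ sincPow (q - 2) t * cos (x * t)) (2 * π * ξ) := by
    rw [weight_eq, show 2 * π * x * ξ = x * (2 * π * ξ) by ring]
    ring
  rw [K_eq_integral hq, funext h, integral_const_mul,
    Measure.integral_comp_mul_left (fun t ↦ sincPow (q - 2) t * cos (x * t)), sincPowCos,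
    smul_eq_mul, abs_of_pos (by positivity)]
  ring

lemma exists_mul_sub_le_sub_of_antitoneOn {g : ℝ → ℝ} {g' b c : ℝ} (hbc : b < c)
    (hanti : AntitoneOn g (Icc b c)) (hderiv : HasDerivAt g g' b) (hg' : g' < 0) :
    ∃ κ > 0, ∀ x ∈ Icc b c, κ * (x - b) ≤ g b - g x := by
  have hslope : ∀ᶠ x in 𝓝[>] b, slope g b x < g' / 2 :=
    ((hasDerivWithinAt_iff_tendsto_slope' self_notMem_Ioi).1
      hderiv.hasDerivWithinAt).eventually_lt_const (by linarith)
  obtain ⟨u, hbu, hu⟩ := mem_nhdsGT_iff_exists_Ioc_subset.1 hslope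
  have hr : b < min u c := lt_min hbu hbc
  have hnear (x : ℝ) (hbx : b ≤ x) (hx : x ≤ min u c) : -(g' / 2) * (x - b) ≤ g b - g x := by
    rcases hbx.eq_or_lt with rfl | hbx
    · simp
    · have := hu ⟨hbx, hx.trans (min_le_left _ _)⟩
      rw [mem_ofPred_eq, slope_def_field, div_lt_iff₀ (by linarith)] at this
      linarith
  have hratio : (min u c - b) / (c - b) ≤ 1 :=
    div_le_one_of_le₀ (by linarith [min_le_right u c]) (by linarith)
  refine ⟨-(g' / 2) * ((min u c - b) / (c - b)),
    mul_pos (by linarith) (div_pos (by linarith) (by linarith)), fun x hx ↦ ?_⟩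
  rcases le_total x (min u c) with h | h
  · refine le_trans ?_ (hnear x hx.1 h)
    exact mul_le_mul_of_nonneg_right (mul_le_of_le_one_right (by linarith) hratio)
      (by linarith [hx.1])
  · calc -(g' / 2) * ((min u c - b) / (c - b)) * (x - b)
        ≤ -(g' / 2) * ((min u c - b) / (c - b)) * (c - b) := by
          refine mul_le_mul_of_nonneg_left (by linarith [hx.2]) ?_
          exact mul_nonneg (by linarith) (div_nonneg (by linarith) (by linarith))
      _ = -(g' / 2) * (min u c - b) := by
          rw [mul_assoc, div_mul_cancel₀ _ (by linarith)]
      _ ≤ g b - g (min u c) := hnear _ hr.le le_rfl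
      _ ≤ g b - g x := by
          linarith [hanti ⟨hr.le, min_le_right u c⟩ hx h]

lemma exists_mul_abs_sub_le_sub_of_antitoneOn {g : ℝ → ℝ} {g' a b c : ℝ} (hab : a < b)
    (hbc : b < c) (hanti : AntitoneOn g (Icc a c)) (hderiv : HasDerivAt g g' b) (hg' : g' < 0) :
    ∃ κ > 0, (∀ x ∈ Icc a b, κ * |x - b| ≤ g x - g b) ∧
      ∀ x ∈ Icc b c, κ * |x - b| ≤ g b - g x := by
  obtain ⟨κ₁, hκ₁, hright⟩ := exists_mul_sub_le_sub_of_antitoneOn hbc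
    (hanti.mono (Icc_subset_Icc_left hab.le)) hderiv hg'
  have hanti' : AntitoneOn (fun x ↦ -g (-x)) (Icc (-b) (-a)) := fun x hx y hy hxy ↦
    neg_le_neg (hanti ⟨by linarith [hy.2], by linarith [hy.1]⟩
      ⟨by linarith [hx.2], by linarith [hx.1]⟩ (neg_le_neg hxy))
  have hderiv' : HasDerivAt (fun x ↦ -g (-x)) g' (-b) := by
    have h : HasDerivAt g g' (- -b) := by rwa [neg_neg]
    exact (h.scomp (-b) (hasDerivAt_neg (-b))).neg.congr_deriv (by simp)
  obtain ⟨κ₂, hκ₂, hleft⟩ :=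
    exists_mul_sub_le_sub_of_antitoneOn (neg_lt_neg hab) hanti' hderiv' hg'
  refine ⟨min κ₁ κ₂, lt_min hκ₁ hκ₂, fun x hx ↦ ?_, fun x hx ↦ ?_⟩
  · have := hleft (-x) ⟨neg_le_neg hx.2, neg_le_neg hx.1⟩
    simp only [neg_neg] at this
    rw [abs_of_nonpos (by linarith [hx.2])]
    nlinarith [min_le_right κ₁ κ₂, hx.2]
  · have := hright x hx
    rw [abs_of_nonneg (by linarith [hx.1])]
    nlinarith [min_le_left κ₁ κ₂, hx.1]

/-- The distance from `x` to the endpoints `±1` of `unitBall`, truncated at `1`. Up to a constant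
it bounds `|K q x - K q 1|` from below, which quantifies the loss in the first-order term of the
expansion of `‖indicatorHat E‖_q ^ q` about `unitBall`. -/
noncomputable def edgeDist (x : ℝ) : ℝ := min 1 (abs (|x| - 1))

lemma edgeDist_nonneg (x : ℝ) : 0 ≤ edgeDist x := le_min zero_le_one (abs_nonneg _)

lemma edgeDist_le_one (x : ℝ) : edgeDist x ≤ 1 := min_le_left _ _

lemma edgeDist_le_abs_abs_sub_one (x : ℝ) : edgeDist x ≤ abs (|x| - 1) := min_le_right _ _

lemma continuous_edgeDist : Continuous edgeDist := by
  unfold edgeDist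
  fun_prop

lemma exists_sincPowCos_gap {s : ℝ} (hs : 1 < s) :
    ∃ κ > 0, ∀ x, (|x| ≤ 1 → κ * edgeDist x ≤ sincPowCos s x - sincPowCos s 1) ∧
      (1 ≤ |x| → κ * edgeDist x ≤ sincPowCos s 1 - sincPowCos s x) := by
  obtain ⟨d, hd, hfar⟩ := exists_sincPowCos_le_sub hs.le
  obtain ⟨κ, hκ, hin, hout⟩ := exists_mul_abs_sub_le_sub_of_antitoneOn zero_lt_one one_lt_two
    (strictAntiOn_sincPowCos hs).antitoneOn (hasDerivAt_sincPowCos hs 1)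
    (by linarith [sincPowSin_pos hs one_pos one_lt_two])
  have hmin (x : ℝ) : min κ d * edgeDist x ≤ κ * abs (|x| - 1) :=
    mul_le_mul (min_le_left _ _) (edgeDist_le_abs_abs_sub_one x) (edgeDist_nonneg x) hκ.le
  refine ⟨min κ d, lt_min hκ hd, fun x ↦ ?_⟩
  rw [← sincPowCos_abs s x]
  refine ⟨fun hx ↦ (hmin x).trans (hin _ ⟨abs_nonneg x, hx⟩), fun hx ↦ ?_⟩
  rcases le_total |x| 2 with hx2 | hx2
  · exact (hmin x).trans (hout _ ⟨hx, hx2⟩)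
  · have : min κ d * edgeDist x ≤ d * 1 :=
      mul_le_mul (min_le_right _ _) (edgeDist_le_one x) (edgeDist_nonneg x) hd.le
    linarith [hfar _ hx2]

lemma exists_K_gap {q : ℝ} (hq : 3 < q) :
    ∃ κ > 0, ∀ x, (|x| ≤ 1 → κ * edgeDist x ≤ K q x - K q 1) ∧
      (1 ≤ |x| → κ * edgeDist x ≤ K q 1 - K q x) := by
  obtain ⟨κ, hκ, h⟩ := exists_sincPowCos_gap (s := q - 2) (by linarith)
  refine ⟨2 * 2 ^ (q - 2) * (2 * π)⁻¹ * κ, by positivity, fun x ↦ ?_⟩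
  rw [K_eq_sincPowCos (by linarith), K_eq_sincPowCos (by linarith), ← mul_sub, ← mul_sub, mul_assoc]
  exact ⟨fun hx ↦ mul_le_mul_of_nonneg_left ((h x).1 hx) (by positivity),
    fun hx ↦ mul_le_mul_of_nonneg_left ((h x).2 hx) (by positivity)⟩

/-! ### Second-order expansion of powers of the norm -/

lemma rpow_sub_rpow_le_mul_sub {u v r : ℝ} (hu : 0 ≤ u) (hv : 0 ≤ v) (hr : 1 ≤ r) :
    u ^ r - v ^ r ≤ r * u ^ (r - 1) * (u - v) := by
  rcases hu.eq_or_lt with rfl | hu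
  · rw [zero_rpow (by linarith)]
    rcases hr.eq_or_lt with rfl | hr
    · simp
    · rw [zero_rpow (by linarith)]
      linarith [rpow_nonneg hv r]
  · have hbernoulli := one_add_mul_self_le_rpow_one_add (s := v / u - 1)
      (by linarith [div_nonneg hv hu.le]) hr
    rw [add_sub_cancel, div_rpow hv hu.le, le_div_iff₀ (by positivity)] at hbernoulli
    have hpow : u ^ r = u ^ (r - 1) * u := by rw [← rpow_add_one hu.ne', sub_add_cancel]
    have hexpand : (1 + r * (v / u - 1)) * u ^ r = u ^ r + r * u ^ (r - 1) * (v - u) := by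
      rw [hpow]
      field_simp
    linarith

lemma abs_rpow_sub_rpow_le {u v c r : ℝ} (hu : 0 ≤ u) (hv : 0 ≤ v) (huc : u ≤ c) (hvc : v ≤ c)
    (hr : 1 ≤ r) : |u ^ r - v ^ r| ≤ r * c ^ (r - 1) * |u - v| := by
  have hle {a b : ℝ} (ha : 0 ≤ a) (hb : 0 ≤ b) (hac : a ≤ c) :
      a ^ r - b ^ r ≤ r * c ^ (r - 1) * |a - b| :=
    calc a ^ r - b ^ r ≤ r * a ^ (r - 1) * (a - b) := rpow_sub_rpow_le_mul_sub ha hb hr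
      _ ≤ r * a ^ (r - 1) * |a - b| := by
          gcongr
          exact le_abs_self _
      _ ≤ r * c ^ (r - 1) * |a - b| := by gcongr
  exact abs_sub_le_iff.2 ⟨hle hu hv huc, abs_sub_comm u v ▸ hle hv hu hvc⟩

lemma rpow_eq_rpow_sub_two_mul_sq {x r : ℝ} (hx : 0 ≤ x) (hr : 2 ≤ r) :
    x ^ r = x ^ (r - 2) * x ^ 2 := by
  rw [← rpow_natCast x 2, ← rpow_add_of_nonneg hx (by linarith) (by positivity)]
  norm_num

lemma rpow_sub_rpow_le_mul_sq_sub {u v r : ℝ} (hu : 0 ≤ u) (hv : 0 ≤ v) (hr : 2 ≤ r) :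
    u ^ r - v ^ r ≤ r / 2 * u ^ (r - 2) * (u ^ 2 - v ^ 2) := by
  have hpow {x : ℝ} (hx : 0 ≤ x) (p : ℝ) : (x ^ 2) ^ p = x ^ (2 * p) := by
    rw [← rpow_natCast, ← rpow_mul hx, Nat.cast_ofNat]
  have h := rpow_sub_rpow_le_mul_sub (r := r / 2) (sq_nonneg u) (sq_nonneg v) (by linarith)
  rwa [hpow hu, hpow hv, hpow hu, mul_div_cancel₀ r two_ne_zero,
    show 2 * (r / 2 - 1) = r - 2 by ring] at h

lemma add_rpow_sub_two_mul_sq_le {u v r : ℝ} (hu : 0 ≤ u) (hv : 0 ≤ v) (hr : 3 ≤ r) :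
    (u + v) ^ (r - 2) * v ^ 2 ≤ 2 ^ (r - 3) * (u ^ (r - 2) * v ^ 2 + v ^ r) := by
  rw [rpow_eq_rpow_sub_two_mul_sq hv (by linarith), ← add_mul, ← mul_assoc]
  refine mul_le_mul_of_nonneg_right ?_ (sq_nonneg _)
  lift u to NNReal using hu
  lift v to NNReal using hv
  have h := NNReal.rpow_add_le_mul_rpow_add_rpow u v (p := r - 2) (by linarith)
  rw [show r - 2 - 1 = r - 3 by ring] at h
  exact_mod_cast h

lemma norm_rpow_sub_mul_norm_sq_sub_le {V : Type*} [SeminormedAddCommGroup V] {q : ℝ} (hq : 3 ≤ q)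
    (x y : V) :
    (‖x + y‖ ^ (q - 2) - ‖x‖ ^ (q - 2)) * (‖x + y‖ ^ 2 - ‖x‖ ^ 2) ≤
      2 * (q - 2) * (‖x‖ + ‖y‖) ^ (q - 2) * ‖y‖ ^ 2 := by
  have hdiff : |‖x + y‖ - ‖x‖| ≤ ‖y‖ := by
    simpa using abs_norm_sub_norm_le (x + y) x
  have hpow : |‖x + y‖ ^ (q - 2) - ‖x‖ ^ (q - 2)| ≤
      (q - 2) * (‖x‖ + ‖y‖) ^ (q - 2 - 1) * ‖y‖ := by
    refine (abs_rpow_sub_rpow_le (norm_nonneg _) (norm_nonneg _) (norm_add_le x y)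
      (by linarith [norm_nonneg y]) (by linarith)).trans ?_
    have : 0 ≤ q - 2 := by linarith
    gcongr
  have hsq : |‖x + y‖ ^ 2 - ‖x‖ ^ 2| ≤ ‖y‖ * (2 * (‖x‖ + ‖y‖)) := by
    rw [sq_sub_sq, abs_mul, abs_of_nonneg (a := ‖x + y‖ + ‖x‖) (by positivity), mul_comm]
    gcongr
    linarith [norm_add_le x y, norm_nonneg y]
  calc (‖x + y‖ ^ (q - 2) - ‖x‖ ^ (q - 2)) * (‖x + y‖ ^ 2 - ‖x‖ ^ 2)
      ≤ |‖x + y‖ ^ (q - 2) - ‖x‖ ^ (q - 2)| * |‖x + y‖ ^ 2 - ‖x‖ ^ 2| :=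
        (le_abs_self _).trans (abs_mul _ _).le
    _ ≤ (q - 2) * (‖x‖ + ‖y‖) ^ (q - 2 - 1) * ‖y‖ * (‖y‖ * (2 * (‖x‖ + ‖y‖))) :=
        mul_le_mul hpow hsq (abs_nonneg _) ((abs_nonneg _).trans hpow)
    _ = 2 * (q - 2) * ((‖x‖ + ‖y‖) ^ (q - 2 - 1) * (‖x‖ + ‖y‖)) * ‖y‖ ^ 2 := by ring
    _ = 2 * (q - 2) * (‖x‖ + ‖y‖) ^ (q - 2) * ‖y‖ ^ 2 := by
        rw [← rpow_add_one' (by positivity) (by linarith), sub_add_cancel]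

lemma norm_add_rpow_le {V : Type*} [SeminormedAddCommGroup V] [InnerProductSpace ℝ V] {q : ℝ}
    (hq : 3 ≤ q) (x y : V) :
    ‖x + y‖ ^ q ≤ ‖x‖ ^ q + q * (‖x‖ ^ (q - 2) * inner ℝ x y) +
      (q / 2 + q * (q - 2) * 2 ^ (q - 3)) * (‖x‖ ^ (q - 2) * ‖y‖ ^ 2 + ‖y‖ ^ q) := by
  have hconvex := rpow_sub_rpow_le_mul_sq_sub (norm_nonneg (x + y)) (norm_nonneg x)
    (r := q) (by linarith)
  have hsplit : q / 2 * ‖x + y‖ ^ (q - 2) * (‖x + y‖ ^ 2 - ‖x‖ ^ 2) =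
      q * (‖x‖ ^ (q - 2) * inner ℝ x y) + q / 2 * (‖x‖ ^ (q - 2) * ‖y‖ ^ 2) +
        q / 2 * ((‖x + y‖ ^ (q - 2) - ‖x‖ ^ (q - 2)) * (‖x + y‖ ^ 2 - ‖x‖ ^ 2)) := by
    rw [norm_add_sq_real]
    ring
  have hremainder : q / 2 * ((‖x + y‖ ^ (q - 2) - ‖x‖ ^ (q - 2)) * (‖x + y‖ ^ 2 - ‖x‖ ^ 2)) ≤
      q * (q - 2) * 2 ^ (q - 3) * (‖x‖ ^ (q - 2) * ‖y‖ ^ 2 + ‖y‖ ^ q) :=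
    calc _ ≤ q / 2 * (2 * (q - 2) * (‖x‖ + ‖y‖) ^ (q - 2) * ‖y‖ ^ 2) :=
          mul_le_mul_of_nonneg_left (norm_rpow_sub_mul_norm_sq_sub_le hq x y) (by linarith)
      _ = q * (q - 2) * ((‖x‖ + ‖y‖) ^ (q - 2) * ‖y‖ ^ 2) := by ring
      _ ≤ q * (q - 2) * (2 ^ (q - 3) * (‖x‖ ^ (q - 2) * ‖y‖ ^ 2 + ‖y‖ ^ q)) :=
          mul_le_mul_of_nonneg_left (add_rpow_sub_two_mul_sq_le (norm_nonneg x) (norm_nonneg y) hq)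
            (mul_nonneg (by linarith) (by linarith))
      _ = _ := by ring
  have hnonneg : 0 ≤ q / 2 * ‖y‖ ^ q := by positivity
  linarith

/-! ### Plancherel's theorem on `L¹ ∩ L²` -/

section Plancherel

variable {V : Type*} [NormedAddCommGroup V] [InnerProductSpace ℝ V] [MeasurableSpace V]
  [BorelSpace V] [FiniteDimensional ℝ V]

lemma continuous_fourier {F : Type*} [NormedAddCommGroup F] [NormedSpace ℂ F] {f : V → F}
    (hf : Integrable f) : Continuous (𝓕 f) :=
  VectorFourier.fourierIntegral_continuous continuous_fourierChar (by exact continuous_inner) hf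

variable {F : Type*} [NormedAddCommGroup F] [InnerProductSpace ℂ F] [CompleteSpace F] {f : V → F}

lemma fourier_toLp_ae_eq (hf : Integrable f) (hf2 : MemLp f 2) :
    ((𝓕 (hf2.toLp f) : Lp F 2 (volume : Measure V)) : V → F) =ᵐ[volume] 𝓕 f := by
  refine ae_eq_of_integral_contDiff_smul_eq ((Lp.memLp _).locallyIntegrable (by norm_num))
    (continuous_fourier hf).locallyIntegrable fun g hg hgc ↦ ?_
  -- Both sides agree as tempered distributions, hence against the test function `g`.
  let ψ : SchwartzMap V ℂ := (hgc.comp_left (g := Complex.ofRealCLM) rfl).toSchwartzMap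
    (Complex.ofRealCLM.contDiff.comp hg)
  have hdistribution := congrArg (fun T ↦ T ψ) (Lp.fourier_toTemperedDistribution_eq (hf2.toLp f))
  simp only [TemperedDistribution.fourier_apply, Lp.toTemperedDistribution_apply] at hdistribution
  have hrepr : ∫ x, (𝓕 ψ : SchwartzMap V ℂ) x • (hf2.toLp f : V → F) x =
      ∫ x, (𝓕 (ψ : V → ℂ)) x • f x := by
    refine integral_congr_ae ?_
    filter_upwards [hf2.coeFn_toLp] with x hx
    rw [hx, SchwartzMap.fourier_coe]
  have hflip : ∫ x, (𝓕 (ψ : V → ℂ)) x • f x = ∫ x, ψ x • 𝓕 f x := by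
    have := VectorFourier.integral_fourierIntegral_smul_eq_flip (L := innerₗ V) (μ := volume)
      (ν := volume) continuous_fourierChar (by exact continuous_inner) ψ.integrable hf
    rwa [flip_innerₗ] at this
  have hψ (x : V) : ψ x = (g x : ℂ) := rfl
  rw [hrepr, hflip] at hdistribution
  simpa only [hψ, Complex.coe_smul] using hdistribution.symm

lemma memLp_two_fourier (hf : Integrable f) (hf2 : MemLp f 2) : MemLp (𝓕 f) 2 :=
  (Lp.memLp _).ae_eq (fourier_toLp_ae_eq hf hf2)

lemma eLpNorm_two_fourier (hf : Integrable f) (hf2 : MemLp f 2) :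
    eLpNorm (𝓕 f) 2 volume = eLpNorm f 2 volume := by
  have h := Lp.norm_fourier_eq (hf2.toLp f)
  rw [Lp.norm_def, Lp.norm_def, eLpNorm_congr_ae (fourier_toLp_ae_eq hf hf2),
    eLpNorm_congr_ae hf2.coeFn_toLp] at h
  exact (ENNReal.toReal_eq_toReal_iff' (memLp_two_fourier hf hf2).2.ne hf2.2.ne).1 h

lemma integral_norm_fourier_sq (hf : Integrable f) (hf2 : MemLp f 2) :
    ∫ ξ, ‖𝓕 f ξ‖ ^ 2 = ∫ x, ‖f x‖ ^ 2 := by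
  have hsq {g : V → F} (hg : MemLp g 2) : ∫ x, ‖g x‖ ^ 2 = (eLpNorm g 2 volume).toReal ^ 2 := by
    rw [toReal_eLpNorm hg.1, lpNorm_eq_integral_norm_rpow_toReal two_ne_zero ENNReal.ofNat_ne_top
      hg.1, ENNReal.toReal_ofNat, ← rpow_mul_natCast (integral_nonneg fun x ↦ by positivity)]
    simp
  rw [hsq hf2, hsq (memLp_two_fourier hf hf2), eLpNorm_two_fourier hf hf2]

end Plancherel

/-! ### Integrals weighted by the distance to the edge -/

lemma integrable_abs_mul_edgeDist {f : ℝ → ℝ} (hf : Integrable f) :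
    Integrable (fun x ↦ |f x| * edgeDist x) := by
  refine hf.abs.mul_bdd (c := 1) continuous_edgeDist.aestronglyMeasurable (ae_of_all _ fun x ↦ ?_)
  rw [norm_of_nonneg (edgeDist_nonneg x)]
  exact edgeDist_le_one x

lemma integral_abs_mul_edgeDist_nonneg (f : ℝ → ℝ) : 0 ≤ ∫ x, |f x| * edgeDist x :=
  integral_nonneg fun x ↦ mul_nonneg (abs_nonneg _) (edgeDist_nonneg x)

lemma volume_setOf_edgeDist_lt_le {r : ℝ} (hr : r ≤ 1) :
    volume {x | edgeDist x < r} ≤ ENNReal.ofReal (4 * r) := by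
  have hsub : {x | edgeDist x < r} ⊆ Ioo (1 - r) (1 + r) ∪ Ioo (-1 - r) (-1 + r) := by
    intro x hx
    have hx' : edgeDist x < r := hx
    rcases min_lt_iff.1 hx' with h | h
    · linarith
    rw [abs_lt] at h
    rcases abs_cases x with ⟨habs, -⟩ | ⟨habs, -⟩ <;> rw [habs] at h
    · exact Or.inl ⟨by linarith, by linarith⟩
    · exact Or.inr ⟨by linarith, by linarith⟩
  calc volume {x | edgeDist x < r}
      ≤ volume (Ioo (1 - r) (1 + r)) + volume (Ioo (-1 - r) (-1 + r)) :=
        (measure_mono hsub).trans (measure_union_le _ _)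
    _ = ENNReal.ofReal (2 * r) + ENNReal.ofReal (2 * r) := by
        rw [Real.volume_Ioo, Real.volume_Ioo]
        ring_nf
    _ = ENNReal.ofReal (4 * r) := by
        rw [← two_mul, ← ENNReal.ofReal_ofNat, ← ENNReal.ofReal_mul zero_le_two]
        ring_nf

lemma mul_integral_abs_sub_le {f : ℝ → ℝ} (hf : Integrable f) (hf1 : ∀ x, |f x| ≤ 1) {r : ℝ}
    (hr0 : 0 ≤ r) (hr1 : r ≤ 1) :
    r * (∫ x, |f x|) - 4 * r ^ 2 ≤ ∫ x, |f x| * edgeDist x := by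
  set U := {x | edgeDist x < r}
  have hUm : MeasurableSet U := measurableSet_lt continuous_edgeDist.measurable measurable_const
  have hUvol := volume_setOf_edgeDist_lt_le hr1
  have hUint : Integrable (U.indicator (1 : ℝ → ℝ)) :=
    (integrable_indicator_iff hUm).2 (integrableOn_const (hUvol.trans_lt ENNReal.ofReal_lt_top).ne)
  have hpointwise (x : ℝ) : r * |f x| - r * U.indicator 1 x ≤ |f x| * edgeDist x := by
    by_cases hx : x ∈ U
    · rw [indicator_of_mem hx, Pi.one_apply]
      nlinarith [hf1 x, mul_nonneg (abs_nonneg (f x)) (edgeDist_nonneg x)]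
    · rw [indicator_of_notMem hx, mul_zero, sub_zero, mul_comm]
      exact mul_le_mul_of_nonneg_left (not_lt.1 hx) (abs_nonneg _)
  have hintegral := integral_mono ((hf.abs.const_mul r).sub (hUint.const_mul r))
    (integrable_abs_mul_edgeDist hf) hpointwise
  have hUreal : volume.real U ≤ 4 * r := ENNReal.toReal_le_of_le_ofReal (by positivity) hUvol
  simp only [Pi.sub_apply] at hintegral
  rw [integral_sub (hf.abs.const_mul r) (hUint.const_mul r), integral_const_mul,
    integral_const_mul, integral_indicator_one hUm] at hintegral
  nlinarith

lemma sq_integral_abs_le {f : ℝ → ℝ} (hf : Integrable f) (hf1 : ∀ x, |f x| ≤ 1)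
    (hf8 : ∫ x, |f x| ≤ 8) : (∫ x, |f x|) ^ 2 ≤ 16 * ∫ x, |f x| * edgeDist x := by
  have : 0 ≤ ∫ x, |f x| := integral_nonneg fun x ↦ abs_nonneg _
  linarith [mul_integral_abs_sub_le hf hf1 (r := (∫ x, |f x|) / 8) (by positivity) (by linarith)]

lemma norm_fourier_ofReal_le (f : ℝ → ℝ) (ξ : ℝ) :
    ‖𝓕 (fun x ↦ (f x : ℂ)) ξ‖ ≤ ∫ x, |f x| :=
  (VectorFourier.norm_fourierIntegral_le_integral_norm 𝐞 volume (innerₗ ℝ) _ ξ).trans_eq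
    (by simp only [Complex.norm_real, norm_eq_abs])

lemma norm_cexp_sub_cexp_le (a b : ℝ) :
    ‖Complex.exp (a * Complex.I) - Complex.exp (b * Complex.I)‖ ≤ min 2 |a - b| := by
  refine le_min ?_ ?_
  · calc _ ≤ ‖Complex.exp (a * Complex.I)‖ + ‖Complex.exp (b * Complex.I)‖ := norm_sub_le _ _
      _ = 2 := by
        rw [Complex.norm_exp_ofReal_mul_I, Complex.norm_exp_ofReal_mul_I, one_add_one_eq_two]
  · have hfactor : Complex.exp (a * Complex.I) - Complex.exp (b * Complex.I) =
        Complex.exp (b * Complex.I) * (Complex.exp (Complex.I * ((a - b : ℝ) : ℂ)) - 1) := by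
      rw [mul_sub, ← Complex.exp_add, mul_one]
      congr 2
      push_cast
      ring
    rw [hfactor, norm_mul, Complex.norm_exp_ofReal_mul_I, one_mul]
    exact norm_exp_I_mul_ofReal_sub_one_le

lemma norm_cexp_sub_ite_cexp_le (x ξ : ℝ) :
    ‖Complex.exp ((-2 * π * x * ξ : ℝ) * Complex.I) -
      if 0 < x then Complex.exp ((-2 * π * 1 * ξ : ℝ) * Complex.I)
      else Complex.exp ((-2 * π * (-1) * ξ : ℝ) * Complex.I)‖ ≤
      2 * π * (1 + |ξ|) * edgeDist x := by
  have hdiff (e : ℝ) : |-2 * π * x * ξ - -2 * π * e * ξ| = 2 * π * |ξ| * |x - e| := by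
    rw [show -2 * π * x * ξ - -2 * π * e * ξ = -(2 * π * ξ * (x - e)) by ring, abs_neg, abs_mul,
      abs_mul, abs_of_pos two_pi_pos]
  calc _ ≤ min 2 (2 * π * |ξ| * abs (|x| - 1)) := by
        split_ifs with hx
        · refine (norm_cexp_sub_cexp_le _ _).trans_eq ?_
          rw [hdiff, abs_of_pos hx]
        · refine (norm_cexp_sub_cexp_le _ _).trans_eq ?_
          rw [hdiff, abs_of_nonpos (not_lt.1 hx), ← abs_neg (x - -1)]
          ring_nf
    _ ≤ min (2 * π * (1 + |ξ|) * 1) (2 * π * (1 + |ξ|) * abs (|x| - 1)) := by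
        gcongr
        · nlinarith [pi_gt_three, abs_nonneg ξ]
        · linarith
    _ = 2 * π * (1 + |ξ|) * edgeDist x := by
        rw [edgeDist, mul_min_of_nonneg _ _ (by positivity)]

section

variable {E : Type*} [NormedAddCommGroup E] [NormedSpace ℂ E] {f : ℝ → E}

lemma integrable_ite_pos_smul (hf : Integrable f) (a b : ℂ) :
    Integrable fun x ↦ (if 0 < x then a else b) • f x :=
  hf.bdd_smul (max ‖a‖ ‖b‖) (Measurable.ite measurableSet_Ioi measurable_const
    measurable_const).aestronglyMeasurable (ae_of_all _ fun x ↦ by split_ifs <;> simp)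

lemma integral_ite_pos_smul (hf : Integrable f) (a b : ℂ) :
    ∫ x, (if 0 < x then a else b) • f x = (a • ∫ x in Ioi 0, f x) + b • ∫ x in Iic 0, f x := by
  have hint := integrable_ite_pos_smul hf a b
  rw [← intervalIntegral.integral_Iic_add_Ioi (b := 0) hint.integrableOn hint.integrableOn,
    add_comm, ← integral_smul, ← integral_smul]
  congr 1
  · exact setIntegral_congr_fun measurableSet_Ioi fun x hx ↦ by simp only [if_pos (mem_Ioi.1 hx)]
  · exact setIntegral_congr_fun measurableSet_Iic fun x hx ↦ by
      simp only [if_neg (not_lt.2 (mem_Iic.1 hx))]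

end

lemma norm_fourier_ofReal_le_integral_mul_edgeDist {f : ℝ → ℝ} (hf : Integrable f)
    (hpos : ∫ x in Ioi 0, f x = 0) (hneg : ∫ x in Iic 0, f x = 0) (ξ : ℝ) :
    ‖𝓕 (fun x ↦ (f x : ℂ)) ξ‖ ≤ 2 * π * (1 + |ξ|) * ∫ x, |f x| * edgeDist x := by
  have hfc : Integrable fun x ↦ (f x : ℂ) := hf.ofReal
  set phase : ℝ → ℂ := fun x ↦ Complex.exp ((-2 * π * x * ξ : ℝ) * Complex.I)
  -- Since `f` has mean zero on either side of `0`, the phase may be compared with its value at the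
  -- nearer endpoint of the ball.
  have hzero : ∫ x, (if 0 < x then phase 1 else phase (-1)) • (f x : ℂ) = 0 := by
    rw [integral_ite_pos_smul hfc, integral_complex_ofReal, integral_complex_ofReal,
      hpos, hneg]
    simp
  have hdiff : 𝓕 (fun x ↦ (f x : ℂ)) ξ =
      ∫ x, (phase x - if 0 < x then phase 1 else phase (-1)) • (f x : ℂ) := by
    have hint : Integrable fun x ↦ phase x • (f x : ℂ) :=
      integrable_cexp_smul hf (Continuous.aestronglyMeasurable (by fun_prop))
    simp only [sub_smul]
    rw [integral_sub hint (integrable_ite_pos_smul hfc _ _), hzero, sub_zero,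
      fourier_real_eq_integral_exp_smul]
  rw [hdiff, ← integral_const_mul]
  refine norm_integral_le_of_norm_le ((integrable_abs_mul_edgeDist hf).const_mul _)
    (ae_of_all _ fun x ↦ ?_)
  rw [norm_smul, Complex.norm_real, norm_eq_abs, mul_comm |f x|, ← mul_assoc]
  exact mul_le_mul_of_nonneg_right (norm_cexp_sub_ite_cexp_le x ξ) (abs_nonneg _)

/-! ### The first-order and second-order weights -/

lemma continuous_K {q : ℝ} (hq : 3 < q) : Continuous (K q) := by
  have hcos : Continuous (sincPowCos (q - 2)) := continuous_iff_continuousAt.2 fun x ↦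
    (hasDerivAt_sincPowCos (by linarith) x).continuousAt
  rw [funext (K_eq_sincPowCos (by linarith))]
  fun_prop

lemma abs_K_le {q : ℝ} (hq : 2 < q) (x : ℝ) : |K q x| ≤ ∫ ξ, |weight q ξ| := by
  rw [K_eq_integral hq, ← norm_eq_abs]
  refine norm_integral_le_of_norm_le (integrable_weight hq).abs (ae_of_all _ fun ξ ↦ ?_)
  rw [norm_mul, norm_eq_abs, norm_eq_abs]
  exact mul_le_of_le_one_right (abs_nonneg _) (abs_cos_le_one _)

lemma integral_weight_mul_re_fourier {q : ℝ} (hq : 2 < q) {f : ℝ → ℝ} (hf : Integrable f) :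
    ∫ ξ, weight q ξ * (𝓕 (fun x ↦ (f x : ℂ)) ξ).re = ∫ x, K q x * f x := by
  have hint : Integrable (fun z : ℝ × ℝ ↦ weight q z.1 * f z.2 * cos (2 * π * z.2 * z.1))
      (volume.prod volume) :=
    ((integrable_weight hq).mul_prod hf).mul_bdd (c := 1)
      (Continuous.aestronglyMeasurable (by fun_prop)) (ae_of_all _ fun z ↦ abs_cos_le_one _)
  calc ∫ ξ, weight q ξ * (𝓕 (fun x ↦ (f x : ℂ)) ξ).re
      = ∫ ξ, ∫ x, weight q ξ * f x * cos (2 * π * x * ξ) := by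
        simp only [re_fourier_ofReal hf, ← integral_const_mul, mul_assoc]
    _ = ∫ x, ∫ ξ, weight q ξ * f x * cos (2 * π * x * ξ) := integral_integral_swap hint
    _ = ∫ x, K q x * f x := by
        simp only [K_eq_integral hq, ← integral_mul_const, mul_right_comm]

lemma exists_integral_K_mul_le {q : ℝ} (hq : 3 < q) :
    ∃ κ > 0, ∀ f : ℝ → ℝ, Integrable f → (∀ x, |x| ≤ 1 → f x ≤ 0) → (∀ x, 1 < |x| → 0 ≤ f x) →
      ∫ x, f x = 0 → ∫ x, K q x * f x ≤ -κ * ∫ x, |f x| * edgeDist x := by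
  obtain ⟨κ, hκ, hgap⟩ := exists_K_gap hq
  refine ⟨κ, hκ, fun f hf hin hout hzero ↦ ?_⟩
  have hKf : Integrable (fun x ↦ K q x * f x) :=
    hf.bdd_mul (continuous_K hq).aestronglyMeasurable
      (ae_of_all _ fun x ↦ abs_K_le (by linarith) x)
  have hpointwise (x : ℝ) : K q x * f x - K q 1 * f x ≤ -κ * (|f x| * edgeDist x) := by
    rcases le_or_gt |x| 1 with hx | hx
    · rw [abs_of_nonpos (hin x hx)]
      nlinarith [hin x hx, (hgap x).1 hx]
    · rw [abs_of_nonneg (hout x hx)]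
      nlinarith [hout x hx, (hgap x).2 hx.le]
  calc ∫ x, K q x * f x = ∫ x, (K q x * f x - K q 1 * f x) := by
        rw [integral_sub hKf (hf.const_mul _), integral_const_mul, hzero, mul_zero, sub_zero]
    _ ≤ ∫ x, -κ * (|f x| * edgeDist x) := integral_mono (hKf.sub (hf.const_mul _))
        ((integrable_abs_mul_edgeDist hf).const_mul _) hpointwise
    _ = -κ * ∫ x, |f x| * edgeDist x := integral_const_mul _ _

lemma rpow_two_sub_mul_rpow_le {δ m c θ : ℝ} (hδ : 0 ≤ δ) (hm : 0 ≤ m) (hc : 1 ≤ c)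
    (hθ0 : 0 < θ) (hθ1 : θ ≤ 1) (h : δ ^ 2 ≤ c * m) : δ ^ (2 - θ) * m ^ θ ≤ c * δ ^ θ * m := by
  have hδ_eq : δ ^ (2 - θ) = δ ^ θ * (δ ^ 2) ^ (1 - θ) := by
    rw [← rpow_two, ← rpow_mul hδ, ← rpow_add_of_nonneg hδ hθ0.le (by linarith)]
    ring_nf
  have hm_eq : m ^ (1 - θ) * m ^ θ = m := by
    rw [← rpow_add_of_nonneg hm (by linarith) hθ0.le, sub_add_cancel, rpow_one]
  have hle : (δ ^ 2) ^ (1 - θ) ≤ c * m ^ (1 - θ) :=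
    calc (δ ^ 2) ^ (1 - θ) ≤ (c * m) ^ (1 - θ) := by
          gcongr
      _ = c ^ (1 - θ) * m ^ (1 - θ) := mul_rpow (by linarith) hm
      _ ≤ c * m ^ (1 - θ) := by
          gcongr
          exact rpow_le_self_of_one_le hc (by linarith)
  calc δ ^ (2 - θ) * m ^ θ ≤ δ ^ θ * (c * m ^ (1 - θ)) * m ^ θ := by
        rw [hδ_eq]
        gcongr
    _ = c * δ ^ θ * m := by rw [mul_assoc, mul_assoc c, hm_eq]; ring

lemma integrable_one_add_abs_rpow_mul_abs_ballHat_rpow {r θ : ℝ} (hr : 0 ≤ r) (hθ : 0 ≤ θ)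
    (h : 1 < r - θ) : Integrable fun ξ ↦ (1 + |ξ|) ^ θ * |ballHat ξ| ^ r := by
  have hsinc := ((integrable_one_add_abs_rpow_mul_abs_sinc_rpow hr h).comp_mul_left'
    (R := 2 * π) (by positivity)).const_mul (2 ^ r)
  have := continuous_ballHat.measurable
  refine hsinc.mono' (by fun_prop) (ae_of_all _ fun ξ ↦ ?_)
  have hdilate : 1 + |ξ| ≤ 1 + |2 * π * ξ| := by
    rw [abs_mul, abs_of_pos two_pi_pos]
    nlinarith [abs_nonneg ξ, pi_gt_three]
  rw [norm_of_nonneg (by positivity), ballHat, abs_mul, mul_rpow (abs_nonneg _) (abs_nonneg _),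
    abs_two, mul_left_comm]
  gcongr

/-! ### Second-order expansion of the `q`-th power integral -/

lemma rpow_mul_rpow_le_rpow_add_add {x y a b : ℝ} (hx : 0 ≤ x) (hy : 0 ≤ y) (ha : 0 ≤ a)
    (hb : 0 ≤ b) : x ^ a * y ^ b ≤ x ^ (a + b) + y ^ (a + b) := by
  rw [rpow_add_of_nonneg hx ha hb, rpow_add_of_nonneg hy ha hb]
  rcases le_total x y with h | h
  · have : x ^ a * y ^ b ≤ y ^ a * y ^ b := by gcongr
    have : 0 ≤ x ^ a * x ^ b := by positivity
    linarith
  · have : x ^ a * y ^ b ≤ x ^ a * x ^ b := by gcongr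
    have : 0 ≤ y ^ a * y ^ b := by positivity
    linarith

lemma rpow_le_rpow_sub_two_mul_sq {x δ q : ℝ} (hx : 0 ≤ x) (hδ : x ≤ δ) (hq : 2 ≤ q) :
    x ^ q ≤ δ ^ (q - 2) * x ^ 2 := by
  rw [rpow_eq_rpow_sub_two_mul_sq hx hq]
  gcongr

section Expansion

variable {α V : Type*} [MeasurableSpace α] {μ : Measure α} [NormedAddCommGroup V] {f g : α → V}
  {q : ℝ}

lemma integrable_norm_rpow_mul_norm_rpow (hf : AEStronglyMeasurable f μ)
    (hg : AEStronglyMeasurable g μ) (hfq : Integrable (fun x ↦ ‖f x‖ ^ q) μ)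
    (hgq : Integrable (fun x ↦ ‖g x‖ ^ q) μ) {a b : ℝ} (ha : 0 ≤ a) (hb : 0 ≤ b)
    (hab : a + b = q) : Integrable (fun x ↦ ‖f x‖ ^ a * ‖g x‖ ^ b) μ := by
  refine (hfq.add hgq).mono' ((hf.norm.aemeasurable.pow_const a).mul
    (hg.norm.aemeasurable.pow_const b)).aestronglyMeasurable (ae_of_all _ fun x ↦ ?_)
  rw [norm_of_nonneg (by positivity), ← hab]
  exact rpow_mul_rpow_le_rpow_add_add (norm_nonneg _) (norm_nonneg _) ha hb

lemma integral_norm_add_rpow_le [InnerProductSpace ℝ V] (hq : 3 ≤ q)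
    (hf : AEStronglyMeasurable f μ) (hg : AEStronglyMeasurable g μ)
    (hfq : Integrable (fun x ↦ ‖f x‖ ^ q) μ) (hgq : Integrable (fun x ↦ ‖g x‖ ^ q) μ) :
    ∫ x, ‖f x + g x‖ ^ q ∂μ ≤
      (∫ x, ‖f x‖ ^ q ∂μ) + q * (∫ x, ‖f x‖ ^ (q - 2) * inner ℝ (f x) (g x) ∂μ) +
        (q / 2 + q * (q - 2) * 2 ^ (q - 3)) *
          ((∫ x, ‖f x‖ ^ (q - 2) * ‖g x‖ ^ 2 ∂μ) + ∫ x, ‖g x‖ ^ q ∂μ) := by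
  have hinner : Integrable (fun x ↦ ‖f x‖ ^ (q - 2) * inner ℝ (f x) (g x)) μ := by
    refine (integrable_norm_rpow_mul_norm_rpow hf hg hfq hgq (a := q - 1) (b := 1) (by linarith)
      zero_le_one (by ring)).mono' ((hf.norm.aemeasurable.pow_const _).mul
        (hf.inner hg).aemeasurable).aestronglyMeasurable (ae_of_all _ fun x ↦ ?_)
    rw [norm_mul, norm_of_nonneg (by positivity), rpow_one,
      show q - 1 = q - 2 + 1 by ring, rpow_add_one' (norm_nonneg _) (by linarith), mul_assoc]
    gcongr
    exact norm_inner_le_norm _ _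
  have hsq : Integrable (fun x ↦ ‖f x‖ ^ (q - 2) * ‖g x‖ ^ 2) μ := by
    simpa only [rpow_two] using integrable_norm_rpow_mul_norm_rpow hf hg hfq hgq
      (a := q - 2) (b := 2) (by linarith) zero_le_two (by ring)
  have hfirst : Integrable (fun x ↦ ‖f x‖ ^ q + q * (‖f x‖ ^ (q - 2) * inner ℝ (f x) (g x))) μ :=
    hfq.add (hinner.const_mul q)
  have hsecond : Integrable (fun x ↦ (q / 2 + q * (q - 2) * 2 ^ (q - 3)) *
      (‖f x‖ ^ (q - 2) * ‖g x‖ ^ 2 + ‖g x‖ ^ q)) μ :=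
    (hsq.add hgq).const_mul _
  rw [← integral_const_mul, ← integral_add hfq (hinner.const_mul q), ← integral_add hsq hgq,
    ← integral_const_mul, ← integral_add hfirst hsecond]
  exact integral_mono_of_nonneg (ae_of_all _ fun x ↦ by positivity) (hfirst.add hsecond)
    (ae_of_all _ fun x ↦ norm_add_rpow_le hq (f x) (g x))

section

variable {δ : ℝ} (hδ : ∀ x, ‖f x‖ ≤ δ)

include hδ

lemma integrable_norm_rpow_of_norm_le (hq : 2 ≤ q) (hf : AEStronglyMeasurable f μ)
    (hf2 : Integrable (fun x ↦ ‖f x‖ ^ 2) μ) : Integrable (fun x ↦ ‖f x‖ ^ q) μ := by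
  refine (hf2.const_mul (δ ^ (q - 2))).mono'
    (hf.norm.aemeasurable.pow_const _).aestronglyMeasurable (ae_of_all _ fun x ↦ ?_)
  rw [norm_of_nonneg (by positivity)]
  exact rpow_le_rpow_sub_two_mul_sq (norm_nonneg _) (hδ x) hq

lemma integral_norm_rpow_le_of_norm_le (hq : 2 ≤ q) (hf2 : Integrable (fun x ↦ ‖f x‖ ^ 2) μ) :
    ∫ x, ‖f x‖ ^ q ∂μ ≤ δ ^ (q - 2) * ∫ x, ‖f x‖ ^ 2 ∂μ := by
  rw [← integral_const_mul]
  exact integral_mono_of_nonneg (ae_of_all _ fun x ↦ by positivity) (hf2.const_mul _)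
    (ae_of_all _ fun x ↦ rpow_le_rpow_sub_two_mul_sq (norm_nonneg _) (hδ x) hq)

lemma integral_mul_norm_sq_le {u M : α → ℝ} {m θ : ℝ} (hu : ∀ x, 0 ≤ u x) (hM : ∀ x, 0 ≤ M x)
    (hm : 0 ≤ m) (hθ0 : 0 ≤ θ) (hθ2 : θ ≤ 2) (hint : Integrable (fun x ↦ M x ^ θ * u x) μ)
    (hfM : ∀ x, ‖f x‖ ≤ M x * m) :
    ∫ x, u x * ‖f x‖ ^ 2 ∂μ ≤ (∫ x, M x ^ θ * u x ∂μ) * (δ ^ (2 - θ) * m ^ θ) := by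
  rw [← integral_mul_const]
  refine integral_mono_of_nonneg (ae_of_all _ fun x ↦ mul_nonneg (hu x) (by positivity))
    (hint.mul_const _) (ae_of_all _ fun x ↦ ?_)
  have hu := hu x
  have hM := hM x
  have hδ0 := (norm_nonneg _).trans (hδ x)
  calc u x * ‖f x‖ ^ 2 = u x * (‖f x‖ ^ (2 - θ) * ‖f x‖ ^ θ) := by
        rw [← rpow_add_of_nonneg (norm_nonneg _) (by linarith) hθ0, sub_add_cancel, rpow_two]
    _ ≤ u x * (δ ^ (2 - θ) * (M x * m) ^ θ) := by
        gcongr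
        · exact hδ x
        · exact hfM x
    _ = M x ^ θ * u x * (δ ^ (2 - θ) * m ^ θ) := by
        rw [mul_rpow hM hm]
        ring

end

end Expansion

lemma integrable_abs_ballHat_rpow {r : ℝ} (hr : 1 < r) : Integrable fun ξ ↦ |ballHat ξ| ^ r := by
  simpa using integrable_one_add_abs_rpow_mul_abs_ballHat_rpow (θ := 0) (by linarith) le_rfl
    (by simpa using hr)

lemma integral_norm_ballHat_add_rpow_le {q : ℝ} (hq : 3 ≤ q) {w : ℝ → ℂ}
    (hw : AEStronglyMeasurable w) (hwq : Integrable fun ξ ↦ ‖w ξ‖ ^ q) :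
    ∫ ξ, ‖(ballHat ξ : ℂ) + w ξ‖ ^ q ≤
      (∫ ξ, |ballHat ξ| ^ q) + q * (∫ ξ, weight q ξ * (w ξ).re) +
        (q / 2 + q * (q - 2) * 2 ^ (q - 3)) *
          ((∫ ξ, |ballHat ξ| ^ (q - 2) * ‖w ξ‖ ^ 2) + ∫ ξ, ‖w ξ‖ ^ q) := by
  have hnorm (ξ : ℝ) : ‖(ballHat ξ : ℂ)‖ = |ballHat ξ| := Complex.norm_real _
  have hinner (ξ : ℝ) : |ballHat ξ| ^ (q - 2) * inner ℝ (ballHat ξ : ℂ) (w ξ) =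
      weight q ξ * (w ξ).re := by
    rw [Complex.inner, Complex.conj_ofReal, mul_comm (w ξ), Complex.re_ofReal_mul, weight]
    ring
  have h := integral_norm_add_rpow_le hq
    (Complex.continuous_ofReal.comp continuous_ballHat).aestronglyMeasurable hw
    (by simpa only [Function.comp_apply, hnorm] using integrable_abs_ballHat_rpow (by linarith)) hwq
  simpa only [Function.comp_apply, hnorm, hinner] using h

lemma norm_ofReal_sq_le_abs {f : ℝ → ℝ} (hf1 : ∀ x, |f x| ≤ 1) (x : ℝ) :
    ‖(f x : ℂ)‖ ^ 2 ≤ |f x| := by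
  rw [Complex.norm_real, norm_eq_abs]
  exact pow_le_of_le_one (abs_nonneg _) (hf1 x) two_ne_zero

section BoundedPerturbation

variable {f : ℝ → ℝ} (hf : Integrable f) (hf1 : ∀ x, |f x| ≤ 1)

include hf hf1

lemma memLp_two_ofReal_of_abs_le_one : MemLp (fun x ↦ (f x : ℂ)) 2 := by
  refine (memLp_two_iff_integrable_sq_norm hf.ofReal.1).2
    (hf.abs.mono' (hf.ofReal.1.norm.pow 2) (ae_of_all _ fun x ↦ ?_))
  rw [norm_of_nonneg (by positivity)]
  exact norm_ofReal_sq_le_abs hf1 x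

lemma integral_norm_fourier_ofReal_sq_le :
    ∫ ξ, ‖𝓕 (fun x ↦ (f x : ℂ)) ξ‖ ^ 2 ≤ ∫ x, |f x| := by
  rw [integral_norm_fourier_sq hf.ofReal (memLp_two_ofReal_of_abs_le_one hf hf1)]
  exact integral_mono_of_nonneg (ae_of_all _ fun x ↦ by positivity) hf.abs
    (ae_of_all _ (norm_ofReal_sq_le_abs hf1))

lemma integrable_norm_fourier_ofReal_sq :
    Integrable fun ξ ↦ ‖𝓕 (fun x ↦ (f x : ℂ)) ξ‖ ^ 2 :=
  (memLp_two_fourier hf.ofReal (memLp_two_ofReal_of_abs_le_one hf hf1)).integrable_norm_pow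
    two_ne_zero

lemma integrable_norm_fourier_ofReal_rpow {q : ℝ} (hq : 2 ≤ q) :
    Integrable fun ξ ↦ ‖𝓕 (fun x ↦ (f x : ℂ)) ξ‖ ^ q :=
  integrable_norm_rpow_of_norm_le (norm_fourier_ofReal_le f) hq
    (continuous_fourier hf.ofReal).aestronglyMeasurable (integrable_norm_fourier_ofReal_sq hf hf1)

lemma integral_norm_fourier_ofReal_rpow_le {q : ℝ} (hq : 2 ≤ q) :
    ∫ ξ, ‖𝓕 (fun x ↦ (f x : ℂ)) ξ‖ ^ q ≤ (∫ x, |f x|) ^ (q - 2) * ∫ x, |f x| :=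
  (integral_norm_rpow_le_of_norm_le (norm_fourier_ofReal_le f) hq
    (integrable_norm_fourier_ofReal_sq hf hf1)).trans <|
    mul_le_mul_of_nonneg_left (integral_norm_fourier_ofReal_sq_le hf hf1)
      (rpow_nonneg (integral_nonneg fun _ ↦ abs_nonneg _) _)

end BoundedPerturbation

lemma exists_remainder_le {q : ℝ} (hq : 3 < q) :
    ∃ D : ℝ, 0 ≤ D ∧ ∃ θ : ℝ, 0 < θ ∧ ∀ f : ℝ → ℝ, Integrable f → (∀ x, |f x| ≤ 1) →
      ∫ x in Ioi 0, f x = 0 → ∫ x in Iic 0, f x = 0 → ∫ x, |f x| ≤ 1 →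
      (∫ ξ, |ballHat ξ| ^ (q - 2) * ‖𝓕 (fun x ↦ (f x : ℂ)) ξ‖ ^ 2) +
          ∫ ξ, ‖𝓕 (fun x ↦ (f x : ℂ)) ξ‖ ^ q ≤
        D * (∫ x, |f x|) ^ θ * ∫ x, |f x| * edgeDist x := by
  obtain ⟨θ, hθ0, hθ⟩ := exists_between (lt_min one_pos (sub_pos.2 hq))
  obtain ⟨hθ1, hθq⟩ := lt_min_iff.1 hθ
  set C := ∫ ξ, (2 * π * (1 + |ξ|)) ^ θ * |ballHat ξ| ^ (q - 2)
  have hint : Integrable fun ξ ↦ (2 * π * (1 + |ξ|)) ^ θ * |ballHat ξ| ^ (q - 2) := by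
    have hmul (ξ : ℝ) : (2 * π * (1 + |ξ|)) ^ θ = (2 * π) ^ θ * (1 + |ξ|) ^ θ :=
      mul_rpow two_pi_pos.le (by positivity)
    simp only [hmul, mul_assoc ((2 * π) ^ θ)]
    exact (integrable_one_add_abs_rpow_mul_abs_ballHat_rpow (r := q - 2) (by linarith) hθ0.le
      (by linarith)).const_mul _
  have hC : 0 ≤ C := integral_nonneg fun ξ ↦ by positivity
  refine ⟨16 * C + 16, by positivity, θ, hθ0, fun f hf hf1 hpos hneg hδ1 ↦ ?_⟩
  set δ := ∫ x, |f x|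
  set m := ∫ x, |f x| * edgeDist x
  have hδ0 : 0 ≤ δ := integral_nonneg fun x ↦ abs_nonneg _
  have hm0 : 0 ≤ m := integral_abs_mul_edgeDist_nonneg f
  have hδm : δ ^ 2 ≤ 16 * m := sq_integral_abs_le hf hf1 (by linarith)
  have hquadratic : ∫ ξ, |ballHat ξ| ^ (q - 2) * ‖𝓕 (fun x ↦ (f x : ℂ)) ξ‖ ^ 2 ≤
      C * (16 * δ ^ θ * m) :=
    (integral_mul_norm_sq_le (norm_fourier_ofReal_le f) (fun ξ ↦ by positivity)
      (fun ξ ↦ by positivity) hm0 hθ0.le (by linarith) hint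
      (norm_fourier_ofReal_le_integral_mul_edgeDist hf hpos hneg)).trans <|
      mul_le_mul_of_nonneg_left
        (rpow_two_sub_mul_rpow_le hδ0 hm0 (by norm_num) hθ0 hθ1.le hδm) hC
  have hpower : ∫ ξ, ‖𝓕 (fun x ↦ (f x : ℂ)) ξ‖ ^ q ≤ 16 * δ ^ θ * m :=
    calc ∫ ξ, ‖𝓕 (fun x ↦ (f x : ℂ)) ξ‖ ^ q ≤ δ ^ (q - 2) * δ :=
          integral_norm_fourier_ofReal_rpow_le hf hf1 (by linarith)
      _ = δ ^ (q - 3) * δ ^ 2 := by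
          rw [show q - 2 = q - 3 + 1 by ring, rpow_add_one' hδ0 (by linarith)]
          ring
      _ ≤ δ ^ θ * (16 * m) := by
          gcongr ?_ * ?_
          exact rpow_le_rpow_of_exponent_ge' hδ0 hδ1 hθ0.le hθq.le
      _ = 16 * δ ^ θ * m := by ring
  linarith

lemma exists_forall_mul_rpow_le {D θ ε : ℝ} (hD : 0 ≤ D) (hθ : 0 < θ) (hε : 0 < ε) :
    ∃ δ₀ > 0, ∀ δ, 0 ≤ δ → δ ≤ δ₀ → D * δ ^ θ ≤ ε := by
  refine ⟨(ε / (D + 1)) ^ θ⁻¹, by positivity, fun δ hδ0 hδ ↦ ?_⟩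
  calc D * δ ^ θ ≤ D * ((ε / (D + 1)) ^ θ⁻¹) ^ θ := by gcongr
    _ = D * (ε / (D + 1)) := by rw [rpow_inv_rpow (by positivity) hθ.ne']
    _ ≤ ε := by
      rw [mul_div_assoc', div_le_iff₀ (by linarith)]
      nlinarith

lemma exists_integral_norm_ballHat_add_fourier_rpow_le {q : ℝ} (hq : 3 < q) :
    ∃ c > 0, ∃ δ₀ > 0, ∀ f : ℝ → ℝ, Integrable f → (∀ x, |f x| ≤ 1) →
      (∀ x, |x| ≤ 1 → f x ≤ 0) → (∀ x, 1 < |x| → 0 ≤ f x) →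
      ∫ x in Ioi 0, f x = 0 → ∫ x in Iic 0, f x = 0 → ∫ x, |f x| ≤ δ₀ →
      ∫ ξ, ‖(ballHat ξ : ℂ) + 𝓕 (fun x ↦ (f x : ℂ)) ξ‖ ^ q ≤
        (∫ ξ, |ballHat ξ| ^ q) - c * (∫ x, |f x|) ^ 2 := by
  obtain ⟨κ, hκ, hfirst⟩ := exists_integral_K_mul_le hq
  obtain ⟨D, hD, θ, hθ, hsecond⟩ := exists_remainder_le hq
  set C := q / 2 + q * (q - 2) * 2 ^ (q - 3)
  have hC : 0 ≤ C := by
    have : 0 ≤ q - 2 := by linarith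
    positivity
  obtain ⟨δ₀, hδ₀, hsmall⟩ := exists_forall_mul_rpow_le (ε := q * κ / 2) (mul_nonneg hC hD) hθ
    (by positivity)
  refine ⟨q * κ / 32, by positivity, min 1 δ₀, by positivity,
    fun f hf hf1 hin hout hpos hneg hδ ↦ ?_⟩
  have hmean : ∫ x, f x = 0 := by
    rw [← intervalIntegral.integral_Iic_add_Ioi (b := 0) hf.integrableOn hf.integrableOn, hpos,
      hneg, add_zero]
  have hexpand := integral_norm_ballHat_add_rpow_le hq.le
    (continuous_fourier hf.ofReal).aestronglyMeasurable
    (integrable_norm_fourier_ofReal_rpow hf hf1 (by linarith))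
  rw [integral_weight_mul_re_fourier (by linarith) hf] at hexpand
  have hremainder := hsecond f hf hf1 hpos hneg (hδ.trans (min_le_left _ _))
  have hgain := hfirst f hf hin hout hmean
  set δ := ∫ x, |f x|
  set m := ∫ x, |f x| * edgeDist x
  have hm : q * κ / 32 * δ ^ 2 ≤ q * κ / 32 * (16 * m) := mul_le_mul_of_nonneg_left
    (sq_integral_abs_le hf hf1 (by linarith [hδ.trans (min_le_left _ _)])) (by positivity)
  have hloss : C * D * δ ^ θ * m ≤ q * κ / 2 * m :=
    mul_le_mul_of_nonneg_right (hsmall δ (integral_nonneg fun x ↦ abs_nonneg _)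
      (hδ.trans (min_le_right _ _))) (integral_abs_mul_edgeDist_nonneg f)
  calc _ ≤ (∫ ξ, |ballHat ξ| ^ q) + q * (-κ * m) + C * (D * δ ^ θ * m) :=
        hexpand.trans (by gcongr)
    _ ≤ (∫ ξ, |ballHat ξ| ^ q) - q * κ / 32 * δ ^ 2 := by linarith

/-! ### Sets close to `unitBall` with median `0` -/

lemma fourier_add_of_integrable {f g : ℝ → ℂ} (hf : Integrable f) (hg : Integrable g) (ξ : ℝ) :
    𝓕 (fun x ↦ f x + g x) ξ = 𝓕 f ξ + 𝓕 g ξ :=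
  congrFun (VectorFourier.fourierIntegral_add (L := innerₗ ℝ) continuous_fourierChar
    (by exact continuous_inner) hf hg) ξ

/-- The perturbation `𝟏_E - 𝟏_{unitBall}` of the indicator function of the ball. -/
noncomputable def excess (E : Set ℝ) (x : ℝ) : ℝ := E.indicator 1 x - unitBall.indicator 1 x

lemma abs_excess (E : Set ℝ) (x : ℝ) : |excess E x| = (unitBall ∆ E).indicator 1 x := by
  by_cases hE : x ∈ E <;> by_cases hB : x ∈ unitBall <;>
    simp [excess, hE, hB, mem_symmDiff, indicator]

lemma abs_excess_le_one (E : Set ℝ) (x : ℝ) : |excess E x| ≤ 1 := by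
  rw [abs_excess]
  exact indicator_le_self' (fun _ _ ↦ zero_le_one) x

lemma excess_nonpos (E : Set ℝ) {x : ℝ} (hx : |x| ≤ 1) : excess E x ≤ 0 := by
  have hxB : x ∈ unitBall := hx
  rw [excess, indicator_of_mem hxB, Pi.one_apply, sub_nonpos]
  exact indicator_le_self' (fun _ _ ↦ zero_le_one) x

lemma excess_nonneg (E : Set ℝ) {x : ℝ} (hx : 1 < |x|) : 0 ≤ excess E x := by
  have hxB : x ∉ unitBall := not_le.2 hx
  rw [excess, indicator_of_notMem hxB, sub_zero]
  exact indicator_nonneg (fun _ _ ↦ zero_le_one) x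

lemma measurableSet_unitBall : MeasurableSet unitBall := by
  rw [unitBall_eq_Icc]
  exact measurableSet_Icc

lemma volume_unitBall : volume unitBall = 2 := by
  rw [unitBall_eq_Icc, Real.volume_Icc]
  norm_num

lemma volume_real_Icc_inter_Ioi {a b t : ℝ} (hat : a ≤ t) (htb : t ≤ b) :
    volume.real (Icc a b ∩ Ioi t) = b - t := by
  have hIoc : Icc a b ∩ Ioi t = Ioc t b := by
    ext x
    simp only [mem_inter_iff, mem_Icc, mem_Ioi, mem_Ioc]
    grind
  rw [hIoc, Real.volume_real_Ioc_of_le htb]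

lemma volume_real_unitBall_inter_Ioi : volume.real (unitBall ∩ Ioi 0) = 1 := by
  rw [unitBall_eq_Icc, volume_real_Icc_inter_Ioi (by norm_num) zero_le_one, sub_zero]

lemma integrable_indicator_one {α : Type*} [MeasurableSpace α] {μ : Measure α} {E : Set α}
    (hE : MeasurableSet E) (h : μ E ≠ ⊤) : Integrable (E.indicator (1 : α → ℝ)) μ :=
  (integrable_indicator_iff hE).2 (integrableOn_const h)

lemma integrable_indicator_unitBall : Integrable (unitBall.indicator (1 : ℝ → ℝ)) :=
  integrable_indicator_one measurableSet_unitBall (volume_unitBall.trans_ne ENNReal.ofNat_ne_top)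

section Excess

variable {E : Set ℝ} (hE : MeasurableSet E)

include hE

lemma integral_abs_excess : ∫ x, |excess E x| = volume.real (unitBall ∆ E) := by
  simp only [abs_excess]
  exact integral_indicator_one (measurableSet_unitBall.symmDiff hE)

variable (hfin : volume E ≠ ⊤)

include hfin

lemma integrable_excess : Integrable (excess E) :=
  (integrable_indicator_one hE hfin).sub integrable_indicator_unitBall

lemma setIntegral_excess (S : Set ℝ) :
    ∫ x in S, excess E x = volume.real (E ∩ S) - volume.real (unitBall ∩ S) := by
  simp only [excess]
  rw [integral_sub (integrable_indicator_one hE hfin).integrableOn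
    integrable_indicator_unitBall.integrableOn, integral_indicator_one hE,
    integral_indicator_one measurableSet_unitBall, measureReal_restrict_apply hE,
    measureReal_restrict_apply measurableSet_unitBall]

lemma indicatorHat_eq_add_excess (ξ : ℝ) :
    indicatorHat E ξ = indicatorHat unitBall ξ + 𝓕 (fun x ↦ (excess E x : ℂ)) ξ := by
  have hofReal (S : Set ℝ) : S.indicator (fun _ : ℝ ↦ (1 : ℂ)) =
      fun x ↦ ((S.indicator (1 : ℝ → ℝ) x : ℝ) : ℂ) := by
    ext x
    by_cases hxS : x ∈ S <;> simp [hxS]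
  have hexcess : (fun x ↦ ((E.indicator (1 : ℝ → ℝ) x : ℝ) : ℂ)) =
      fun x ↦ ((unitBall.indicator (1 : ℝ → ℝ) x : ℝ) : ℂ) + (excess E x : ℂ) := by
    ext x
    rw [excess, Complex.ofReal_sub, add_sub_cancel]
  rw [indicatorHat, indicatorHat, hofReal, hofReal, hexcess]
  exact fourier_add_of_integrable integrable_indicator_unitBall.ofReal
    (integrable_excess hE hfin).ofReal ξ

end Excess

lemma integral_excess_Ioi {E : Set ℝ} (hE : MeasurableSet E) (hE2 : volume E = 2)
    (hmedian : volume (E ∩ Ioi 0) = 1) : ∫ x in Ioi 0, excess E x = 0 := by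
  rw [setIntegral_excess hE (hE2.trans_ne ENNReal.ofNat_ne_top), volume_real_unitBall_inter_Ioi,
    measureReal_def, hmedian, ENNReal.toReal_one, sub_self]

lemma integral_excess_Iic {E : Set ℝ} (hE : MeasurableSet E) (hE2 : volume E = 2)
    (hmedian : volume (E ∩ Ioi 0) = 1) : ∫ x in Iic 0, excess E x = 0 := by
  have hfin : volume E ≠ ⊤ := hE2.trans_ne ENNReal.ofNat_ne_top
  have htotal : ∫ x, excess E x = 0 := by
    rw [← setIntegral_univ, setIntegral_excess hE hfin, inter_univ, inter_univ, measureReal_def,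
      measureReal_def, hE2, volume_unitBall, sub_self]
  have hint := integrable_excess hE hfin
  rw [← intervalIntegral.integral_Iic_add_Ioi (b := 0) hint.integrableOn hint.integrableOn,
    integral_excess_Ioi hE hE2 hmedian, add_zero] at htotal
  exact htotal

lemma exists_integral_norm_indicatorHat_rpow_le {q : ℝ} (hq : 3 < q) :
    ∃ c > 0, ∃ δ₀ > 0, ∀ E : Set ℝ, MeasurableSet E → volume E = 2 →
      volume (E ∩ Ioi 0) = 1 → volume.real (unitBall ∆ E) ≤ δ₀ →
      ∫ ξ, ‖indicatorHat E ξ‖ ^ q ≤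
        (∫ ξ, ‖indicatorHat unitBall ξ‖ ^ q) - c * volume.real (unitBall ∆ E) ^ 2 := by
  obtain ⟨c, hc, δ₀, hδ₀, h⟩ := exists_integral_norm_ballHat_add_fourier_rpow_le hq
  refine ⟨c, hc, δ₀, hδ₀, fun E hE hE2 hmedian hδ ↦ ?_⟩
  have hfin : volume E ≠ ⊤ := hE2.trans_ne ENNReal.ofNat_ne_top
  rw [← integral_abs_excess hE] at hδ ⊢
  simp only [indicatorHat_eq_add_excess hE hfin, indicatorHat_unitBall, Complex.norm_real,
    norm_eq_abs]
  exact h (excess E) (integrable_excess hE hfin) (abs_excess_le_one E) (fun _ ↦ excess_nonpos E)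
    (fun _ ↦ excess_nonneg E) (integral_excess_Ioi hE hE2 hmedian)
    (integral_excess_Iic hE hE2 hmedian) hδ

/-! ### Affine changes of variable -/

lemma continuous_indicatorHat {E : Set ℝ} (hE : MeasurableSet E) (hfin : volume E ≠ ⊤) :
    Continuous (indicatorHat E) :=
  continuous_fourier ((integrable_indicator_iff hE).2 (integrableOn_const hfin))

lemma Phi_eq {q : ℝ} (hq : 0 < q) {E : Set ℝ} (hE : MeasurableSet E) (hfin : volume E ≠ ⊤) :
    Phi q E = volume.real E ^ (-((q - 1) / q)) * (∫ ξ, ‖indicatorHat E ξ‖ ^ q) ^ q⁻¹ := by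
  have hmeas := (continuous_indicatorHat hE hfin).aestronglyMeasurable (μ := volume)
  rw [Phi, one_div_div, toReal_eLpNorm hmeas,
    lpNorm_eq_integral_norm_rpow_toReal (ENNReal.ofReal_pos.2 hq).ne' ENNReal.ofReal_ne_top hmeas,
    ENNReal.toReal_ofReal hq.le, measureReal_def]

/-- The affine copy `(E - c) / r` of `E`, written as the preimage of `E` under `y ↦ c + r * y`.
It is used to normalize `E` to measure `2` and median `0`. -/
def rescale (c r : ℝ) (E : Set ℝ) : Set ℝ := (fun y ↦ r * y) ⁻¹' ((fun x ↦ c + x) ⁻¹' E)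

lemma mem_rescale {c r : ℝ} {E : Set ℝ} {y : ℝ} : y ∈ rescale c r E ↔ c + r * y ∈ E := Iff.rfl

lemma measurableSet_rescale (c r : ℝ) {E : Set ℝ} (hE : MeasurableSet E) :
    MeasurableSet (rescale c r E) :=
  measurable_const_mul r (measurable_const_add c hE)

lemma integral_comp_add_mul {F : Type*} [NormedAddCommGroup F] [NormedSpace ℝ F] (g : ℝ → F)
    (c r : ℝ) : ∫ y, g (c + r * y) = |r⁻¹| • ∫ x, g x := by
  rw [Measure.integral_comp_mul_left (fun x ↦ g (c + x)), integral_add_left_eq_self]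

section Rescale

variable {r : ℝ} (hr : 0 < r) (c : ℝ) (E : Set ℝ)

include hr

lemma volume_rescale : volume (rescale c r E) = ENNReal.ofReal r⁻¹ * volume E := by
  rw [rescale, Real.volume_preimage_mul_left hr.ne', measure_preimage_add,
    abs_of_pos (inv_pos.2 hr)]

lemma volume_real_rescale : volume.real (rescale c r E) = r⁻¹ * volume.real E := by
  rw [measureReal_def, volume_rescale hr, ENNReal.toReal_mul,
    ENNReal.toReal_ofReal (inv_pos.2 hr).le, measureReal_def]

lemma unitBall_symmDiff_rescale :
    unitBall ∆ rescale c r E = rescale c r (Icc (c - r) (c + r) ∆ E) := by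
  have hball (y : ℝ) : y ∈ unitBall ↔ c + r * y ∈ Icc (c - r) (c + r) := by
    rw [unitBall_eq_Icc, mem_Icc, mem_Icc]
    constructor <;> rintro ⟨hleft, hright⟩ <;> constructor <;> nlinarith
  ext y
  simp only [mem_symmDiff, mem_rescale, hball]

lemma rescale_inter_Ioi_zero : rescale c r E ∩ Ioi 0 = rescale c r (E ∩ Ioi c) := by
  ext y
  simp only [mem_inter_iff, mem_rescale, mem_Ioi, lt_add_iff_pos_right, mul_pos_iff_of_pos_left hr]

lemma indicatorHat_rescale (ξ : ℝ) :
    indicatorHat (rescale c r E) ξ =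
      Complex.exp ((2 * π * c * (r⁻¹ * ξ) : ℝ) * Complex.I) *
        (r⁻¹ • indicatorHat E (r⁻¹ * ξ)) := by
  let g (x : ℝ) : ℂ := Complex.exp ((-2 * π * x * (r⁻¹ * ξ) : ℝ) * Complex.I) •
    E.indicator (fun _ ↦ (1 : ℂ)) x
  have hphase (y : ℝ) : ((-2 * π * y * ξ : ℝ) : ℂ) * Complex.I =
      (2 * π * c * (r⁻¹ * ξ) : ℝ) * Complex.I +
        (-2 * π * (c + r * y) * (r⁻¹ * ξ) : ℝ) * Complex.I := by
    rw [← add_mul, ← Complex.ofReal_add]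
    congr 2
    field_simp
    ring
  have hintegrand (y : ℝ) : Complex.exp ((-2 * π * y * ξ : ℝ) * Complex.I) •
      (rescale c r E).indicator (fun _ ↦ (1 : ℂ)) y =
        Complex.exp ((2 * π * c * (r⁻¹ * ξ) : ℝ) * Complex.I) * g (c + r * y) := by
    rw [hphase, Complex.exp_add, smul_eq_mul, mul_assoc]
    rfl
  rw [indicatorHat, indicatorHat, fourier_real_eq_integral_exp_smul,
    fourier_real_eq_integral_exp_smul]
  simp only [hintegrand]
  rw [integral_const_mul, integral_comp_add_mul, abs_of_pos (inv_pos.2 hr)]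

lemma norm_indicatorHat_rescale (ξ : ℝ) :
    ‖indicatorHat (rescale c r E) ξ‖ = r⁻¹ * ‖indicatorHat E (r⁻¹ * ξ)‖ := by
  rw [indicatorHat_rescale hr, norm_mul, Complex.norm_exp_ofReal_mul_I, one_mul, norm_smul,
    norm_of_nonneg (inv_pos.2 hr).le]

lemma integral_norm_indicatorHat_rescale_rpow (q : ℝ) :
    ∫ ξ, ‖indicatorHat (rescale c r E) ξ‖ ^ q =
      r⁻¹ ^ (q - 1) * ∫ ξ, ‖indicatorHat E ξ‖ ^ q := by
  simp only [norm_indicatorHat_rescale hr, mul_rpow (inv_pos.2 hr).le (norm_nonneg _)]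
  rw [integral_const_mul, Measure.integral_comp_mul_left (fun ζ ↦ ‖indicatorHat E ζ‖ ^ q),
    inv_inv, abs_of_pos hr, smul_eq_mul, ← mul_assoc, rpow_sub_one (inv_pos.2 hr).ne',
    div_inv_eq_mul]

variable {E}

lemma Phi_rescale {q : ℝ} (hq : 0 < q) (hE : MeasurableSet E) (hfin : volume E ≠ ⊤) :
    Phi q (rescale c r E) = Phi q E := by
  have hfin' : volume (rescale c r E) ≠ ⊤ := by
    rw [volume_rescale hr]
    exact ENNReal.mul_ne_top ENNReal.ofReal_ne_top hfin
  have hri : 0 < r⁻¹ := inv_pos.2 hr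
  have hI : 0 ≤ ∫ ξ, ‖indicatorHat E ξ‖ ^ q := integral_nonneg fun _ ↦ by positivity
  have hscale : r⁻¹ ^ (-((q - 1) / q)) * (r⁻¹ ^ (q - 1)) ^ q⁻¹ = 1 := by
    rw [← rpow_mul hri.le, ← rpow_add hri, ← div_eq_mul_inv, neg_add_cancel, rpow_zero]
  rw [Phi_eq hq hE hfin, Phi_eq hq (measurableSet_rescale c r hE) hfin', volume_real_rescale hr,
    integral_norm_indicatorHat_rescale_rpow hr, mul_rpow hri.le measureReal_nonneg,
    mul_rpow (by positivity) hI, mul_mul_mul_comm, hscale, one_mul]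

end Rescale

lemma Phi_congr {q : ℝ} {E F : Set ℝ} (h : E =ᵐ[volume] F) : Phi q E = Phi q F := by
  have hhat : indicatorHat E = indicatorHat F := by
    ext ξ
    exact fourier_congr_ae (indicator_ae_eq_of_ae_eq_set h) ξ
  rw [Phi, Phi, hhat, measure_congr h]

lemma distEllipsoids_congr {E F : Set ℝ} (h : E =ᵐ[volume] F) :
    distEllipsoids E = distEllipsoids F := by
  have hdiff (S : Set ℝ) : volume (S ∆ E) = volume (S ∆ F) :=
    measure_congr (ae_eq_set_symmDiff (EventuallyEq.refl _ S) h)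
  simp only [distEllipsoids, hdiff, measure_congr h]

/-! ### Normalization of sets close to an interval -/

lemma distEllipsoids_nonneg (E : Set ℝ) : 0 ≤ distEllipsoids E := by
  refine Real.sInf_nonneg ?_
  rintro _ ⟨S, -, -, rfl⟩
  positivity

lemma distEllipsoids_le {E : Set ℝ} (hfin : volume E ≠ ⊤) {r : ℝ} (hr : 0 < r)
    (hE : volume.real E = 2 * r) (c : ℝ) :
    distEllipsoids E ≤ volume.real (unitBall ∆ rescale c r E) / 2 := by
  refine csInf_le ⟨0, ?_⟩ ⟨Icc (c - r) (c + r), (isEllipsoid_iff _).2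
    ⟨c - r, c + r, by linarith, rfl⟩, ?_, ?_⟩
  · rintro _ ⟨S, -, -, rfl⟩
    positivity
  · rw [Real.volume_Icc, ← ofReal_measureReal hfin, hE, add_sub_sub_cancel, two_mul]
  · rw [unitBall_symmDiff_rescale hr, volume_real_rescale hr, ← measureReal_def, ← measureReal_def,
      hE]
    field_simp

lemma exists_Icc_of_distEllipsoids_lt {E : Set ℝ} (hpos : 0 < volume E) (hfin : volume E ≠ ⊤)
    {η : ℝ} (hη : distEllipsoids E < η) :
    ∃ c r : ℝ, 0 < r ∧ volume.real E = 2 * r ∧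
      volume.real (Icc (c - r) (c + r) ∆ E) < η * (2 * r) := by
  have hE : 0 < volume.real E := ENNReal.toReal_pos hpos.ne' hfin
  have hnonempty : {x : ℝ | ∃ S : Set ℝ, IsEllipsoid S ∧ volume S = volume E ∧
      x = (volume (S ∆ E)).toReal / (volume E).toReal}.Nonempty := by
    refine ⟨_, Icc 0 (volume.real E), (isEllipsoid_iff _).2 ⟨0, _, hE, rfl⟩, ?_, rfl⟩
    rw [Real.volume_Icc, sub_zero, ofReal_measureReal hfin]
  obtain ⟨_, ⟨S, hS, hSE, rfl⟩, hlt⟩ := exists_lt_of_csInf_lt hnonempty hη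
  obtain ⟨a, b, hab, rfl⟩ := (isEllipsoid_iff _).1 hS
  have hlength : volume.real E = b - a := by
    rw [measureReal_def, ← hSE, Real.volume_Icc, ENNReal.toReal_ofReal (by linarith)]
  refine ⟨(a + b) / 2, (b - a) / 2, by linarith, by linarith, ?_⟩
  have hleft : (a + b) / 2 - (b - a) / 2 = a := by ring
  have hright : (a + b) / 2 + (b - a) / 2 = b := by ring
  rwa [hleft, hright, mul_div_cancel₀ _ two_ne_zero, ← hlength, ← div_lt_iff₀ hE]

lemma continuous_measureReal_inter_Ioi {E : Set ℝ} (hE : MeasurableSet E) (hfin : volume E ≠ ⊤) :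
    Continuous fun t ↦ volume.real (E ∩ Ioi t) := by
  have hint := integrable_indicator_one hE hfin
  have hsub (t : ℝ) : volume.real (E ∩ Ioi t) =
      (∫ x in Ioi (0 : ℝ), E.indicator (1 : ℝ → ℝ) x) -
        ∫ x in (0 : ℝ)..t, E.indicator (1 : ℝ → ℝ) x := by
    rw [← intervalIntegral.integral_interval_add_Ioi (b := t) hint.integrableOn hint.integrableOn,
      add_sub_cancel_left, integral_indicator_one hE, measureReal_restrict_apply hE]
  simp only [hsub]
  exact continuous_const.sub
    (intervalIntegral.continuous_primitive (fun _ _ ↦ hint.intervalIntegrable) 0)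

lemma measureReal_inter_le_add {α : Type*} [MeasurableSpace α] {μ : Measure α} {A E : Set α}
    (hA : μ A ≠ ⊤) (hE : μ E ≠ ⊤) (s : Set α) :
    μ.real (A ∩ s) ≤ μ.real (E ∩ s) + μ.real (A ∆ E) := by
  have hEs : μ (E ∩ s) ≠ ⊤ := measure_ne_top_of_subset inter_subset_left hE
  have hdiff : μ (A ∆ E) ≠ ⊤ :=
    measure_ne_top_of_subset symmDiff_subset_union (measure_union_ne_top hA hE)
  refine (measureReal_mono ?_ (measure_union_ne_top hEs hdiff)).trans (measureReal_union_le _ _)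
  rintro x ⟨hxA, hxs⟩
  by_cases hxE : x ∈ E
  · exact Or.inl ⟨hxE, hxs⟩
  · exact Or.inr (Or.inl ⟨hxA, hxE⟩)

/-- The function `t ↦ |E ∩ (t, ∞)|` differs by at most `|I ∆ E|` from `t ↦ |I ∩ (t, ∞)|`, where
`I = [c - r, c + r]`, so it crosses the value `r` within `|I ∆ E|` of `c`. -/
lemma exists_volume_real_inter_Ioi_eq {E : Set ℝ} (hE : MeasurableSet E) (hfin : volume E ≠ ⊤)
    {c r : ℝ} (hε : volume.real (Icc (c - r) (c + r) ∆ E) ≤ r) :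
    ∃ m, |m - c| ≤ volume.real (Icc (c - r) (c + r) ∆ E) ∧ volume.real (E ∩ Ioi m) = r := by
  set I := Icc (c - r) (c + r)
  set ε := volume.real (I ∆ E)
  have hε0 : 0 ≤ ε := measureReal_nonneg
  have hI : volume I ≠ ⊤ := measure_Icc_lt_top.ne
  have hlower : r ≤ volume.real (E ∩ Ioi (c - ε)) := by
    have h := measureReal_inter_le_add hI hfin (Ioi (c - ε))
    rw [volume_real_Icc_inter_Ioi (by linarith) (by linarith)] at h
    linarith
  have hupper : volume.real (E ∩ Ioi (c + ε)) ≤ r := by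
    have h := measureReal_inter_le_add hfin hI (Ioi (c + ε))
    rw [volume_real_Icc_inter_Ioi (by linarith) (by linarith), symmDiff_comm] at h
    linarith
  obtain ⟨m, hm, hmr⟩ := intermediate_value_Icc' (by linarith : c - ε ≤ c + ε)
    (continuous_measureReal_inter_Ioi hE hfin).continuousOn ⟨hupper, hlower⟩
  exact ⟨m, abs_le.2 ⟨by linarith [hm.1], by linarith [hm.2]⟩, hmr⟩

lemma Icc_symmDiff_Icc_subset {α : Type*} [LinearOrder α] (a b a' b' : α) :
    Icc a b ∆ Icc a' b' ⊆ uIcc a' a ∪ uIcc b' b := by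
  intro x hx
  simp only [mem_symmDiff, mem_union, mem_uIcc, mem_Icc] at hx ⊢
  grind

lemma volume_real_Icc_symmDiff_Icc_le (a b a' b' : ℝ) :
    volume.real (Icc a b ∆ Icc a' b') ≤ |a - a'| + |b - b'| := by
  calc volume.real (Icc a b ∆ Icc a' b')
      ≤ volume.real (uIcc a' a ∪ uIcc b' b) :=
        measureReal_mono (Icc_symmDiff_Icc_subset a b a' b')
          (measure_union_ne_top isCompact_uIcc.measure_ne_top isCompact_uIcc.measure_ne_top)
    _ ≤ volume.real (uIcc a' a) + volume.real (uIcc b' b) := measureReal_union_le _ _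
    _ = |a - a'| + |b - b'| := by rw [Real.volume_real_interval, Real.volume_real_interval]

lemma exists_rescale {E : Set ℝ} (hE : MeasurableSet E) (hpos : 0 < volume E)
    (hfin : volume E ≠ ⊤) {η : ℝ} (hη_le : η ≤ 1 / 2) (hη : distEllipsoids E < η) :
    ∃ c r : ℝ, 0 < r ∧ volume (rescale c r E) = 2 ∧ volume (rescale c r E ∩ Ioi 0) = 1 ∧
      distEllipsoids E ≤ volume.real (unitBall ∆ rescale c r E) / 2 ∧
      volume.real (unitBall ∆ rescale c r E) ≤ 6 * η := by
  obtain ⟨c, r, hr, hEr, hlt⟩ := exists_Icc_of_distEllipsoids_lt hpos hfin hη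
  obtain ⟨m, hm, hmr⟩ := exists_volume_real_inter_Ioi_eq hE hfin (c := c) (r := r) (by nlinarith)
  have hscale {S : Set ℝ} (hS : volume S ≠ ⊤) :
      volume (rescale m r S) = ENNReal.ofReal (r⁻¹ * volume.real S) := by
    rw [volume_rescale hr, ENNReal.ofReal_mul (inv_pos.2 hr).le, ofReal_measureReal hS]
  refine ⟨m, r, hr, ?_, ?_, distEllipsoids_le hfin hr hEr m, ?_⟩
  · rw [hscale hfin, hEr, mul_left_comm, inv_mul_cancel₀ hr.ne', mul_one, ENNReal.ofReal_ofNat]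
  · rw [rescale_inter_Ioi_zero hr, hscale (measure_ne_top_of_subset inter_subset_left hfin), hmr,
      inv_mul_cancel₀ hr.ne', ENNReal.ofReal_one]
  · have hshift := volume_real_Icc_symmDiff_Icc_le (m - r) (m + r) (c - r) (c + r)
    rw [sub_sub_sub_cancel_right, add_sub_add_right_eq_sub] at hshift
    rw [unitBall_symmDiff_rescale hr, volume_real_rescale hr, inv_mul_le_iff₀ hr]
    linarith [measureReal_symmDiff_le (μ := volume) (s := Icc (m - r) (m + r))
      (t := Icc (c - r) (c + r)) E measure_Icc_lt_top.ne measure_Icc_lt_top.ne]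

/-! ### Conclusion -/

lemma sub_rpow_inv_le {A t q : ℝ} (hA : 0 < A) (hq : 1 ≤ q) (htA : t ≤ A) :
    (A - t) ^ q⁻¹ ≤ A ^ q⁻¹ - A ^ q⁻¹ * (q * A)⁻¹ * t := by
  have : 0 < q := by linarith
  have hfactor : A - t = A * (1 + -(t / A)) := by field_simp; ring
  have hratio : t / A ≤ 1 := (div_le_one hA).2 htA
  rw [hfactor, mul_rpow hA.le (by linarith)]
  calc A ^ q⁻¹ * (1 + -(t / A)) ^ q⁻¹
      ≤ A ^ q⁻¹ * (1 + q⁻¹ * -(t / A)) := by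
        gcongr
        exact rpow_one_add_le_one_add_mul_self (by linarith) (by positivity)
          (inv_le_one_of_one_le₀ hq)
    _ = A ^ q⁻¹ - A ^ q⁻¹ * (q * A)⁻¹ * t := by field_simp; ring

lemma integral_norm_indicatorHat_unitBall_rpow_pos {q : ℝ} (hq : 1 < q) :
    0 < ∫ ξ, ‖indicatorHat unitBall ξ‖ ^ q := by
  simp only [indicatorHat_unitBall, Complex.norm_real, norm_eq_abs]
  refine integral_pos_of_integrable_nonneg_nonzero (x := 0)
    (continuous_ballHat.abs.rpow_const fun _ ↦ Or.inr (by linarith))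
    (integrable_abs_ballHat_rpow hq) (fun _ ↦ by positivity) ?_
  rw [ballHat, mul_zero, sinc_zero]
  positivity

lemma exists_Phi_le_of_volume_eq_two {q : ℝ} (hq : 3 < q) :
    ∃ c > 0, ∃ δ₀ > 0, ∀ E : Set ℝ, MeasurableSet E → volume E = 2 →
      volume (E ∩ Ioi 0) = 1 → volume.real (unitBall ∆ E) ≤ δ₀ →
      Phi q E ≤ Phi q unitBall - c * volume.real (unitBall ∆ E) ^ 2 := by
  obtain ⟨c, hc, δ₀, hδ₀, hle⟩ := exists_integral_norm_indicatorHat_rpow_le hq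
  have hq0 : 0 < q := by linarith
  have hA : 0 < ∫ ξ, ‖indicatorHat unitBall ξ‖ ^ q :=
    integral_norm_indicatorHat_unitBall_rpow_pos (by linarith)
  set A := ∫ ξ, ‖indicatorHat unitBall ξ‖ ^ q with hA_def
  refine ⟨2 ^ (-((q - 1) / q)) * (A ^ q⁻¹ * (q * A)⁻¹ * c), by positivity, δ₀, hδ₀,
    fun E hE hE2 hmedian hδ ↦ ?_⟩
  have hPhi {S : Set ℝ} (hS : MeasurableSet S) (hS2 : volume S = 2) :
      Phi q S = 2 ^ (-((q - 1) / q)) * (∫ ξ, ‖indicatorHat S ξ‖ ^ q) ^ q⁻¹ := by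
    rw [Phi_eq hq0 hS (hS2.trans_ne ENNReal.ofNat_ne_top), measureReal_def, hS2,
      ENNReal.toReal_ofNat]
  have hX : 0 ≤ ∫ ξ, ‖indicatorHat E ξ‖ ^ q := integral_nonneg fun _ ↦ by positivity
  have hXA := hle E hE hE2 hmedian hδ
  rw [hPhi hE hE2, hPhi measurableSet_unitBall volume_unitBall, ← hA_def]
  calc 2 ^ (-((q - 1) / q)) * (∫ ξ, ‖indicatorHat E ξ‖ ^ q) ^ q⁻¹
      ≤ 2 ^ (-((q - 1) / q)) * (A - c * volume.real (unitBall ∆ E) ^ 2) ^ q⁻¹ := by gcongr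
    _ ≤ 2 ^ (-((q - 1) / q)) *
          (A ^ q⁻¹ - A ^ q⁻¹ * (q * A)⁻¹ * (c * volume.real (unitBall ∆ E) ^ 2)) := by
        gcongr
        exact sub_rpow_inv_le hA (by linarith) (by linarith)
    _ = _ := by ring

end FourierExtremizer

open FourierExtremizer in
theorem proposition2p8_general (q : ℝ) (hq : 3 < q) :
    ∃ c : ℝ, 0 < c ∧ ∃ η : ℝ, 0 < η ∧
      ∀ E : Set ℝ, NullMeasurableSet E volume → 0 < volume E → volume E < ⊤ →
        distEllipsoids E < η → Phi q E ≤ Phi q unitBall - c * distEllipsoids E ^ 2 := by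
  obtain ⟨c, hc, δ₀, hδ₀, hle⟩ := exists_Phi_le_of_volume_eq_two hq
  refine ⟨4 * c, by positivity, min (1 / 2) (δ₀ / 6), by positivity,
    fun E₀ hE₀ hpos hfin hη ↦ ?_⟩
  obtain ⟨E, -, hE, hEE₀⟩ := hE₀.exists_measurable_superset_ae_eq
  rw [← measure_congr hEE₀] at hpos hfin
  rw [← distEllipsoids_congr hEE₀] at hη ⊢
  rw [← Phi_congr hEE₀]
  obtain ⟨m, r, hr, hvol, hmedian, hdist, hsmall⟩ :=
    exists_rescale hE hpos hfin.ne (min_le_left _ _) hη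
  have hδ : volume.real (unitBall ∆ rescale m r E) ≤ δ₀ := by
    linarith [min_le_right (1 / 2) (δ₀ / 6)]
  have hsq : (2 * distEllipsoids E) ^ 2 ≤ volume.real (unitBall ∆ rescale m r E) ^ 2 :=
    pow_le_pow_left₀ (mul_nonneg zero_le_two (distEllipsoids_nonneg E)) (by linarith) 2
  calc Phi q E = Phi q (rescale m r E) := (Phi_rescale hr m (by linarith) hE hfin.ne).symm
    _ ≤ Phi q unitBall - c * volume.real (unitBall ∆ rescale m r E) ^ 2 :=
        hle _ (measurableSet_rescale m r hE) hvol hmedian hδ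
    _ ≤ Phi q unitBall - c * (2 * distEllipsoids E) ^ 2 := by gcongr
    _ = Phi q unitBall - 4 * c * distEllipsoids E ^ 2 := by ring

theorem proposition2p8 (q : ℝ) (hq : 3 < q)
    (hK : ∀ δ : ℝ, 0 < δ → δ ≤ 1 →
      sSup (FourierExtremizer.K q '' {x : ℝ | 1 + δ ≤ |x|}) <
        sInf (FourierExtremizer.K q '' {x : ℝ | |x| ≤ 1 - δ})) :
    ∃ c : ℝ, 0 < c ∧ ∃ η : ℝ, 0 < η ∧
      ∀ E : Set ℝ, NullMeasurableSet E volume → 0 < volume E → volume E < ⊤ →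
        FourierExtremizer.distEllipsoids E < η →
          FourierExtremizer.Phi q E ≤ FourierExtremizer.Phi q FourierExtremizer.unitBall -
            c * FourierExtremizer.distEllipsoids E ^ 2 :=
  proposition2p8_general q hq
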